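/- All sets, signatures, algebras and families of variables are small with respect to a fixed universe, and $\mathbf{Set}$, $\mathbf{Cat}$ are the corresponding categories of sets and of categories. **Signatures, algebras, terms.** A (many-sorted) signature is a pair $(S,\Sigma)$ of a set $S$ of sorts and sets $\Sigma_{w,s}$ of operation symbols for $w\in S^\star$ (the words on $S$), $s\in S$. For an $S$-sorted set $A$ and a word $w$ let $A_w=\prod_{i<|w|}A_{w_i}$; let ${\downarrow}w$ be the $S$-sorted set of variables $v_i$ of sort $w_i$, $i<|w|$, so that $A_w=\mathrm{Hom}({\downarrow}w,A)$. $\mathbf{Alg}(\Sigma)$ is the category of $\Sigma$-algebras and homomorphisms, $\mathrm T_\Sigma(X)$ the free $\Sigma$-algebra on the $S$-sorted set $X$, and $f^\sharp:\mathrm T_\Sigma(X)\to A$ the extension of $f:X\to A$. $\mathbf{Ter}(\Sigma)$ is the dual of the Kleisli category of the monad $\mathrm T_\Sigma$: its objects are the $S$-sorted sets, a morphism $P:X\to Y$ is a sorted map $Y\to\mathrm T_\Sigma(X)$, the composite of $P:X\to Y$ and $Q:Y\to Z$ is $P^\sharp\circ Q$. The functor $\mathrm{Tr}^\Sigma:\mathbf{Alg}(\Sigma)\times\mathbf{Ter}(\Sigma)\to\mathbf{Set}$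 (term realization) sends $(A,X)$ to $\mathrm{Hom}(X,A)$ and $(f,P):(A,X)\to(B,Y)$ to $u\mapsto f\circ u^\sharp\circ P$. **The 2-category $\mathbf{Sig}_{\mathfrak{pd}}$.** Its objects are the signatures. A 1-cell (polyderivor) $\mathbf d=(\varphi,d):(S,\Sigma)\to(T,\Lambda)$ consists of a map $\varphi:S\to T^\star$ and of maps $d_{w,s}:\Sigma_{w,s}\to \mathrm T_\Lambda({\downarrow}\varphi^\sharp(w))_{\varphi(s)}$, where $\varphi^\sharp(w)$ is the concatenation of the words $\varphi(w_i)$. The map $d^\sharp$ extends $d$ to all terms with variables in some ${\downarrow}w$, by taking $v_i$ to the block of variables of $\varphi^\sharp(w)$ that belongs to $\varphi(w_i)$ and commuting with substitution. The composite of $(\varphi,d)$ and $(\psi,e)$ is $(\psi^\sharp\circ\varphi,\,e^\sharp\circ d)$; the identity is given by $s\mapsto(s)$ and $\sigma\mapsto\sigma(v_0,\dots,v_{n-1})$. A 2-cell (transformation) $\xi:\mathbf d\rightsquigarrow\mathbf e$, where $\mathbf d=(\varphi,d)$, $\mathbf e=(\psi,e)$, is a family of $\xi_s\in\mathrm T_\Lambda({\downarrow}\varphi(s))_{\psi(s)}$,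 $s\in S$, with $\xi_s\circ d(\sigma)=e(\sigma)\circ\xi_w$ (substitution of terms) for all $\sigma\in\Sigma_{w,s}$, where $\xi_w$ is the concatenation of the $\xi_{w_i}$, each in its own block of variables. Vertical composition is $(\chi_s\circ\xi_s)_s$; the horizontal composite of $\xi:(\varphi,d)\rightsquigarrow(\psi,e)$ and $\chi:(\varphi',h)\rightsquigarrow(\psi',k)$ is $(\chi_{\psi(s)}\circ h^\sharp(\xi_s))_s=(k^\sharp(\xi_s)\circ\chi_{\varphi(s)})_s$; identities are given by the variables. **$\mathbf{Alg}_{\mathfrak{pd}}$** sends $\Sigma$ to $\mathbf{Alg}(\Sigma)$; a polyderivor $\mathbf d=(\varphi,d):\Sigma\to\Lambda$ to the functor $\mathbf d^*:\mathbf{Alg}(\Lambda)\to\mathbf{Alg}(\Sigma)$, where $\mathbf d^*B$ has the carriers $B_{\varphi(s)}$ and $\sigma\in\Sigma_{w,s}$ operates on it as the realization of the terms $d(\sigma)$, via $\prod_iB_{\varphi(w_i)}\cong B_{\varphi^\sharp(w)}$; a transformation $\xi$ to the natural transformation with the components $B_{\varphi(s)}\to B_{\psi(s)}$, the realizations of $\xi_s$.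 Its structural isomorphisms are given by $\prod_iB_{\psi(\varphi(s)_i)}\cong B_{\psi^\sharp(\varphi(s))}$ and $B_s\cong B_{(s)}$. **$\mathbf{Ter}_{\mathfrak{pd}}$** sends $\Sigma$ to $\mathbf{Ter}(\Sigma)$; a polyderivor $\mathbf d$ to the functor $\mathbf d_\diamond:\mathbf{Ter}(\Sigma)\to\mathbf{Ter}(\Lambda)$, which sends $X$ to $\coprod^\dagger_\varphi X$, $(\coprod^\dagger_\varphi X)_t=\{(x,s,\varphi(s),j)\mid x\in X_s,\ \varphi(s)_j=t\}$, and $P:Y\to\mathrm T_\Sigma(X)$ to the sorted map $\coprod^\dagger_\varphi Y\to\mathrm T_\Lambda(\coprod^\dagger_\varphi X)$, $(y,s,\varphi(s),j)\mapsto(\eta^{\mathbf d}_X(P(y)))_j$, where $\eta^{\mathbf d}_X:\mathrm T_\Sigma(X)\to\mathbf d^*\mathrm T_\Lambda(\coprod^\dagger_\varphi X)$ is the homomorphism that extends $x\mapsto((x,s,\varphi(s),j))_j$; a transformation $\xi:\mathbf d\rightsquigarrow\mathbf e$ to the natural transformation whose component at $X$ is the sorted map $\coprod^\dagger_\psi X\to\mathrm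 T_\Lambda(\coprod^\dagger_\varphi X)$ that takes $(x,s,\psi(s),i)$ to $(\xi_s)_i$ with $v_j$ replaced by $(x,s,\varphi(s),j)$. Its structural isomorphisms are given by the relabelling bijections $\coprod^\dagger_\psi\coprod^\dagger_\varphi X\cong\coprod^\dagger_{\psi^\sharp\circ\varphi}X$ and $X\cong\coprod^\dagger_{\mathrm{id}}X$. For a polyderivor $\mathbf d:\Sigma\to\Lambda$ let $\theta^{\mathbf d}:\mathrm{Tr}^\Sigma\circ(\mathbf d^*\times 1)\Rightarrow\mathrm{Tr}^\Lambda\circ(1\times\mathbf d_\diamond)$ be the natural isomorphism, between functors $\mathbf{Alg}(\Lambda)\times\mathbf{Ter}(\Sigma)\to\mathbf{Set}$, with the components $\mathrm{Hom}(X,\mathbf d^*A)\cong\mathrm{Hom}(\coprod^\dagger_\varphi X,A)$, $f\mapsto\bigl((x,s,\varphi(s),i)\mapsto f(x)_i\bigr)$. **Theorem.** 1. $\mathbf{Alg}_{\mathfrak{pd}}$, with the data above, is a pseudo-functor $\mathbf{Sig}_{\mathfrak{pd}}^{\mathrm{op}}\to\mathbf{Cat}$ (contravariant on 1-cells, covariant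 on 2-cells), and $\mathbf{Ter}_{\mathfrak{pd}}$ is a pseudo-functor $\mathbf{Sig}_{\mathfrak{pd}}\to\mathbf{Cat}$. 2. $\mathbf{Alg}_{\mathfrak{pd}}(\cdot)\times\mathbf{Ter}_{\mathfrak{pd}}(\cdot)$, which sends $(\Sigma,\Lambda)$ to $\mathbf{Alg}(\Sigma)\times\mathbf{Ter}(\Lambda)$, $(\mathbf d,\mathbf e)$ to $\mathbf d^*\times\mathbf e_\diamond$, and likewise on 2-cells and structural isomorphisms, is a pseudo-functor $\mathbf{Sig}_{\mathfrak{pd}}^{\mathrm{op}}\times\mathbf{Sig}_{\mathfrak{pd}}\to\mathbf{Cat}$. 3. $(\mathrm{Tr},\theta)$ is a pseudo-extranatural transformation from this pseudo-functor $F$ to the constant functor at $\mathbf{Set}$. That is, with $F(\mathbf d,1)$ and $F(1,\mathbf d)$ identified with $\mathbf d^*\times1$ and $1\times\mathbf d_\diamond$ along the unit isomorphisms of $F$, the invertible 2-cells $\theta^{\mathbf d}:\mathrm{Tr}^\Sigma\circ F(\mathbf d,1)\Rightarrow\mathrm{Tr}^\Lambda\circ F(1,\mathbf d)$ satisfy: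 (a) $\theta^{\mathbf e}\circ(\mathrm{Tr}^\Sigma * F(\xi,1))=(\mathrm{Tr}^\Lambda * F(1,\xi))\circ\theta^{\mathbf d}$ for every 2-cell $\xi:\mathbf d\rightsquigarrow\mathbf e$; (b) for $\mathbf d:\Sigma\to\Lambda$ and $\mathbf e:\Lambda\to\Omega$, $\theta^{\mathbf e\circ\mathbf d}$ is the pasting of $\theta^{\mathbf d} * F(\mathbf e,1)$ and $\theta^{\mathbf e} * F(1,\mathbf d)$ along the structural isomorphisms $F(\mathbf e\circ\mathbf d,1)\cong F(\mathbf d,1)\circ F(\mathbf e,1)$, $F(1,\mathbf d)\circ F(\mathbf e,1)\cong F(\mathbf e,1)\circ F(1,\mathbf d)$ and $F(1,\mathbf e)\circ F(1,\mathbf d)\cong F(1,\mathbf e\circ\mathbf d)$ of $F$; (c) $\theta^{1_\Sigma}\circ(\mathrm{Tr}^\Sigma * \nu)=\mathrm{Tr}^\Sigma * \nu$ for the unit isomorphism $\nu:1\Rightarrow F(1_\Sigma,1_\Sigma)$. 4. Consequently $(\mathbf{Sig}_{\mathfrak{pd}},\mathbf{Alg}_{\mathfrak{pd}},\mathbf{Ter}_{\mathfrak{pd}},(\mathrm{Tr},\theta))$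 is a 2-institution on $\mathbf{Set}$ (the term 2-institution of Fujiwara), where a 2-institution on a category $\mathbf C$ is a quadruple $(\mathbf{Sig},\mathrm{Mod},\mathrm{Sen},(\alpha,\beta))$ of a 2-category $\mathbf{Sig}$, pseudo-functors $\mathrm{Mod}:\mathbf{Sig}^{\mathrm{op}}\to\mathbf{Cat}$ and $\mathrm{Sen}:\mathbf{Sig}\to\mathbf{Cat}$, and a pseudo-extranatural transformation $(\alpha,\beta)$ from $\mathrm{Mod}(\cdot)\times\mathrm{Sen}(\cdot)$ to the constant functor at $\mathbf C$. -/

import Mathlib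

open CategoryTheory Opposite
open scoped Bicategory

universe u v v' v''

namespace ManySorted

/-! ### Sorted families, words, signatures, algebras, terms -/

/-- The set `(↓w)_s` of variables of sort `s` of the word `w`: the positions `i` of `w` that carry
the letter `s`. -/
@[ext]
structure Var {S : Type u} (w : List S) (s : S) : Type where
  pos : ℕ
  get : w[pos]? = some s

/-- Sorted maps between sorted families of sets. -/
abbrev SMap {S : Type u} (X : S → Type v) (Y : S → Type v') := ∀ s, X s → Y s

/-- `A_w = A_{w_0} × ⋯ × A_{w_{n-1}}`; the coordinate of `a` at the position `i` of `w`, where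
`w_i = s`, is `a s i ∈ A_s`. Thus `A_w` is also the set of sorted maps `↓w → A`. -/
abbrev Tup {S : Type u} (A : S → Type v) (w : List S) := SMap (Var w) A

/-- A many-sorted signature: a set of sorts, and for all `(w, s)` a set of formal operations of
arity `w` and coarity `s`. -/
structure Signature where
  sorts : Type u
  ops : List sorts → sorts → Type u

/-- The structure of a `Σ`-algebra on a sorted set. -/
structure Algebra (Sg : Signature.{u}) where
  carrier : Sg.sorts → Type v
  op : ∀ {w : List Sg.sorts} {s : Sg.sorts}, Sg.ops w s → Tup carrier w → carrier s

/-- Homomorphisms of `Σ`-algebras. -/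
@[ext]
structure Algebra.Hom {Sg : Signature.{u}} (A : Algebra.{u, v} Sg) (B : Algebra.{u, v'} Sg) where
  map : SMap A.carrier B.carrier
  map_op : ∀ {w : List Sg.sorts} {s : Sg.sorts} (σ : Sg.ops w s) (a : Tup A.carrier w),
    map s (A.op σ a) = B.op σ (fun t i => map t (a t i))

/-- The terms for `Σ` with variables in the sorted set `X`. -/
inductive Term (Sg : Signature.{u}) (X : Sg.sorts → Type v) : Sg.sorts → Type (max u v)
  | var {s : Sg.sorts} (x : X s) : Term Sg X s
  | app {w : List Sg.sorts} {s : Sg.sorts} (σ : Sg.ops w s)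
      (args : ∀ t, Var w t → Term Sg X t) : Term Sg X s

/-- The free `Σ`-algebra `T_Σ(X)`. -/
@[reducible] def termAlg (Sg : Signature.{u}) (X : Sg.sorts → Type v) : Algebra.{u, max u v} Sg where
  carrier := Term Sg X
  op σ a := Term.app σ a

/-- The canonical extension `a^♯ : T_Σ(X) → A` of `a : X → A`. -/
def Algebra.eval {Sg : Signature.{u}} (A : Algebra.{u, v} Sg) {X : Sg.sorts → Type v'}
    (a : SMap X A.carrier) {s : Sg.sorts} : Term Sg X s → A.carrier s
  | .var x => a s x
  | .app σ args => A.op σ (fun t i => A.eval a (args t i))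

/-- Substitution: the canonical extension `T_Σ(X) → T_Σ(Y)` of `f : X → T_Σ(Y)`. -/
abbrev Term.bind {Sg : Signature.{u}} {X : Sg.sorts → Type v} {Y : Sg.sorts → Type v'}
    (f : SMap X (Term Sg Y)) {s : Sg.sorts} (P : Term Sg X s) : Term Sg Y s :=
  (termAlg Sg Y).eval f P

section basic

variable {Sg : Signature.{u}}

theorem Algebra.eval_var (A : Algebra.{u, v} Sg) {X : Sg.sorts → Type v'}
    (a : SMap X A.carrier) {s} (x : X s) : A.eval a (Term.var x) = a s x := by
  simp only [Algebra.eval]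

theorem Algebra.eval_app (A : Algebra.{u, v} Sg) {X : Sg.sorts → Type v'}
    (a : SMap X A.carrier) {w s} (σ : Sg.ops w s) (args : Tup (Term Sg X) w) :
    A.eval a (Term.app σ args) = A.op σ (fun t i => A.eval a (args t i)) := by
  simp only [Algebra.eval]

theorem Algebra.Hom.map_eval {A : Algebra.{u, v} Sg} {B : Algebra.{u, v'} Sg} (h : A.Hom B)
    {X : Sg.sorts → Type v''} (a : SMap X A.carrier) {s} (P : Term Sg X s) :
    h.map s (A.eval a P) = B.eval (fun t x => h.map t (a t x)) P := by
  induction P with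
  | var x => simp only [Algebra.eval]
  | app σ args ih => simp only [Algebra.eval, h.map_op, ih]

/-- The extension as a homomorphism. -/
def Algebra.evalHom (A : Algebra.{u, v} Sg) {X : Sg.sorts → Type v'}
    (a : SMap X A.carrier) : (termAlg Sg X).Hom A where
  map _ P := A.eval a P
  map_op σ args := A.eval_app a σ args

theorem Algebra.eval_bind (A : Algebra.{u, v} Sg) {X : Sg.sorts → Type v'}
    {Y : Sg.sorts → Type v''} (a : SMap Y A.carrier) (f : SMap X (Term Sg Y)) {s}
    (P : Term Sg X s) : A.eval a (P.bind f) = A.eval (fun t x => A.eval a (f t x)) P :=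
  (A.evalHom a).map_eval f P

theorem Term.bind_var {X : Sg.sorts → Type v} {s} (P : Term Sg X s) :
    P.bind (fun _ x => Term.var x) = P := by
  change (termAlg Sg X).eval _ P = P
  induction P with
  | var x => rfl
  | app σ args ih => exact congrArg (Term.app σ) (funext fun t => funext fun i => ih t i)

theorem Term.var_bind {X : Sg.sorts → Type v} {Y : Sg.sorts → Type v'}
    (f : SMap X (Term Sg Y)) {s} (x : X s) : (Term.var x).bind f = f s x := rfl

theorem Term.bind_bind {X : Sg.sorts → Type v} {Y : Sg.sorts → Type v'} {Z : Sg.sorts → Type v''}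
    (g : SMap Y (Term Sg Z)) (f : SMap X (Term Sg Y)) {s} (P : Term Sg X s) :
    (P.bind f).bind g = P.bind (fun t x => (f t x).bind g) :=
  Algebra.eval_bind _ _ _ _

/-- Composition in the category of terms: `Q ⋄ P`. -/
abbrev kcomp {X : Sg.sorts → Type v} {Y : Sg.sorts → Type v'} {Z : Sg.sorts → Type v''}
    (P : SMap Y (Term Sg X)) (Q : SMap Z (Term Sg Y)) : SMap Z (Term Sg X) :=
  fun s z => (Q s z).bind P

end basic

/-! ### Substituting words for letters -/

section flat

variable {S : Type u} {T : Type u} (φ : S → List T)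

/-- The position in `φ^♯(w)` at which the block that replaces the `i`-th letter begins. -/
def offset (w : List S) (i : ℕ) : ℕ := ((w.take i).flatMap φ).length

theorem flatMap_getElem?_offset (w : List S) {s : S} {i : ℕ} (hi : w[i]? = some s) {j : ℕ} {t : T}
    (hj : (φ s)[j]? = some t) : (w.flatMap φ)[offset φ w i + j]? = some t := by
  induction w generalizing i with
  | nil => simp at hi
  | cons a w ih =>
    cases i with
    | zero =>
      simp at hi; subst hi
      have := (List.getElem?_eq_some_iff.1 hj).1
      simp [offset, List.getElem?_append_left this, hj]
    | succ i =>
      simp at hi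
      have := ih hi
      simp only [offset, List.take_succ_cons, List.flatMap_cons, List.length_append] at this ⊢
      rw [List.getElem?_append_right (by omega), ← this]
      congr 1; omega

/-- The variable of `φ^♯(w)` that stands at the position `j` of the block `φ(w_i)`. -/
def Var.join {w : List S} {s : S} {t : T} (i : Var w s) (j : Var (φ s) t) : Var (w.flatMap φ) t :=
  ⟨offset φ w i.pos + j.pos, flatMap_getElem?_offset φ w i.get j.get⟩

theorem Var.join_bijective (w : List S) (t : T) : Function.Bijective
    (fun p : Σ s : S, Var w s × Var (φ s) t => Var.join φ p.2.1 p.2.2) := by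
  induction w with
  | nil =>
    constructor
    · rintro ⟨s, ⟨i, hi⟩, j⟩; simp at hi
    · rintro ⟨k, hk⟩; simp at hk
  | cons a w ih =>
    constructor
    · rintro ⟨s, ⟨i, hi⟩, ⟨j, hj⟩⟩ ⟨s', ⟨i', hi'⟩, ⟨j', hj'⟩⟩ h
      have e := congrArg Var.pos h
      clear h
      simp only [Var.join, offset] at e
      have lj := (List.getElem?_eq_some_iff.1 hj).1
      have lj' := (List.getElem?_eq_some_iff.1 hj').1
      cases i with
      | zero =>
        have es : a = s := by simpa using hi
        subst es
        cases i' with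
        | zero =>
          have es : a = s' := by simpa using hi'
          subst es
          simp at e; subst e; rfl
        | succ i' =>
          simp only [List.take_succ_cons, List.flatMap_cons, List.length_append] at e
          simp at e; omega
      | succ i =>
        cases i' with
        | zero =>
          have es : a = s' := by simpa using hi'
          subst es
          simp only [List.take_succ_cons, List.flatMap_cons, List.length_append] at e
          simp at e; omega
        | succ i' =>
          simp only [List.take_succ_cons, List.flatMap_cons, List.length_append] at e
          have := @ih.1 ⟨s, ⟨i, by simpa using hi⟩, ⟨j, hj⟩⟩ ⟨s', ⟨i', by simpa using hi'⟩, ⟨j', hj'⟩⟩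
            (Var.ext (by simp only [Var.join, offset]; omega))
          cases this; rfl
    · rintro ⟨k, hk⟩
      by_cases hlt : k < (φ a).length
      · refine ⟨⟨a, ⟨0, by simp⟩, ⟨k, ?_⟩⟩, Var.ext ?_⟩
        · simpa [List.getElem?_append_left hlt] using hk
        · simp [Var.join, offset]
      · have hk' : (w.flatMap φ)[k - (φ a).length]? = some t := by
          simpa [List.getElem?_append_right (not_lt.1 hlt)] using hk
        obtain ⟨⟨s, ⟨i, hi⟩, ⟨j, hj⟩⟩, h⟩ := ih.2 ⟨_, hk'⟩
        refine ⟨⟨s, ⟨i + 1, by simpa using hi⟩, ⟨j, hj⟩⟩, Var.ext ?_⟩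
        have h := congrArg Var.pos h
        simp only [Var.join, offset, List.take_succ_cons, List.flatMap_cons,
          List.length_append] at h ⊢
        omega

/-- Every variable of `φ^♯(w)` stands in exactly one block. -/
noncomputable def Var.joinEquiv (w : List S) (t : T) :
    (Σ s : S, Var w s × Var (φ s) t) ≃ Var (w.flatMap φ) t :=
  Equiv.ofBijective _ (Var.join_bijective φ w t)

/-- The flattening `∏_i A_{φ(w_i)} → A_{φ^♯(w)}`. -/
noncomputable def flat {A : T → Type v} {w : List S} (a : ∀ s, Var w s → Tup A (φ s)) :
    Tup A (w.flatMap φ) :=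
  fun t k => a _ ((Var.joinEquiv φ w t).symm k).2.1 t ((Var.joinEquiv φ w t).symm k).2.2

variable {φ}

@[simp]
theorem flat_join {A : T → Type v} {w : List S} (a : ∀ s, Var w s → Tup A (φ s)) {s : S} {t : T}
    (i : Var w s) (j : Var (φ s) t) : flat φ a t (Var.join φ i j) = a s i t j := by
  have : Var.join φ i j = Var.joinEquiv φ w t ⟨s, i, j⟩ := rfl
  rw [this, flat, Equiv.symm_apply_apply]

theorem exists_join {w : List S} {t : T} (k : Var (w.flatMap φ) t) :
    ∃ (s : S) (i : Var w s) (j : Var (φ s) t), k = Var.join φ i j := by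
  obtain ⟨⟨s, i, j⟩, h⟩ := (Var.join_bijective φ w t).2 k
  exact ⟨s, i, j, h.symm⟩

theorem flat_ext {A : T → Type v} {w : List S} {a b : Tup A (w.flatMap φ)}
    (h : ∀ s (i : Var w s) t (j : Var (φ s) t), a t (Var.join φ i j) = b t (Var.join φ i j)) :
    a = b := by
  funext t k
  obtain ⟨s, i, j, rfl⟩ := exists_join k
  exact h s i t j

/-- Variables of equal words. -/
def Var.cast {w w' : List S} (h : w = w') {s : S} (i : Var w s) : Var w' s := ⟨i.pos, h ▸ i.get⟩

@[simp] theorem Var.cast_rfl {w : List S} {s : S} (h : w = w) (i : Var w s) : i.cast h = i := rfl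

@[simp] theorem Var.cast_cast {w w' w'' : List S} (h : w = w') (h' : w' = w'') {s : S}
    (i : Var w s) : (i.cast h).cast h' = i.cast (h.trans h') := rfl

theorem take_flatMap_offset (φ : S → List T) (w : List S) {s : S} {i : ℕ} (hi : w[i]? = some s)
    (j : ℕ) (hj : j ≤ (φ s).length) :
    (w.flatMap φ).take (offset φ w i + j) = (w.take i).flatMap φ ++ (φ s).take j := by
  induction w generalizing i with
  | nil => simp at hi
  | cons a w ih =>
    cases i with
    | zero => simp at hi; subst hi; simp [offset, List.take_append_of_le_length hj]
    | succ i =>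
      simp at hi
      have := ih hi
      simp only [offset, List.take_succ_cons, List.flatMap_cons, List.length_append] at this ⊢
      rw [add_assoc, List.take_length_add_append, this, List.append_assoc]

theorem Var.join_join {R : Type u} (φ : S → List T) (ψ : T → List R) {w : List S} {s : S} {t : T}
    {r : R} (i : Var w s) (j : Var (φ s) t) (k : Var (ψ t) r)
    (h : (w.flatMap φ).flatMap ψ = w.flatMap (fun s => (φ s).flatMap ψ)) :
    (Var.join ψ (Var.join φ i j) k).cast h =
      Var.join (fun s => (φ s).flatMap ψ) i (Var.join ψ j k) := by
  apply Var.ext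
  have lj := (List.getElem?_eq_some_iff.1 j.get).1
  simp only [Var.cast, Var.join]
  rw [offset, take_flatMap_offset φ w i.get j.pos lj.le]
  simp [offset, List.flatMap_assoc, add_assoc]

theorem Var.join_single {s : S} {t : T} (i : Var [s] s) (j : Var (φ s) t)
    (h : [s].flatMap φ = φ s) : (Var.join φ i j).cast h = j := by
  apply Var.ext
  have : i.pos = 0 := by
    have := (List.getElem?_eq_some_iff.1 i.get).1
    simp at this; exact this
  simp [Var.cast, Var.join, offset, this]

/-- The only variable of a one-letter word. -/
def Var.one (s : S) : Var [s] s := ⟨0, by simp⟩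

theorem Var.eq_one {s t : S} (j : Var [s] t) : ∃ e : s = t, j = e ▸ Var.one s := by
  obtain ⟨j, hj⟩ := j
  have := (List.getElem?_eq_some_iff.1 hj).1
  simp at this; subst this
  simp at hj; subst hj
  exact ⟨rfl, rfl⟩

theorem Var.one_induction {s : S} {C : ∀ t, Var [s] t → Prop} (h : C s (Var.one s)) (t : S)
    (j : Var [s] t) : C t j := by
  obtain ⟨rfl, rfl⟩ := Var.eq_one j
  exact h

theorem Var.join_one {w : List S} {s : S} (i : Var w s) (h : w.flatMap (fun s => [s]) = w) :
    (Var.join (fun s => [s]) i (Var.one s)).cast h = i := by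
  apply Var.ext
  have := (List.getElem?_eq_some_iff.1 i.get).1
  simp only [Var.cast, Var.join, offset, Var.one]
  simp [List.flatMap_singleton', this.le]

theorem Var.join_unit_join {w : List S} {s : S} (i : Var w s) {t : T} (j : Var (φ s) t) :
    (Var.join φ (Var.join (fun s => [s]) i (Var.one s)) j).cast
      (congrArg (List.flatMap φ) (List.flatMap_singleton' w)) = Var.join φ i j := by
  conv_rhs => rw [← Var.join_one i (List.flatMap_singleton' w)]
  generalize Var.join (fun s => [s]) i (Var.one s) = i
  generalize List.flatMap_singleton' w = h
  generalize w.flatMap (fun s => [s]) = w' at *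
  subst h
  rfl

/-- An element of `A_s` as an element of `A_w`, where `w` is the one-letter word `(s)`. -/
def single {A : S → Type v} {s : S} (a : A s) : Tup A [s] :=
  fun t j => have e : s = t := (Var.eq_one j).1; e ▸ a

@[simp] theorem single_one {A : S → Type v} {s : S} (a : A s) : single a s (Var.one s) = a := rfl

theorem single_ext {A : S → Type v} {s : S} {a b : Tup A [s]}
    (h : a s (Var.one s) = b s (Var.one s)) : a = b := by
  funext t j
  exact Var.one_induction (C := fun t j => a t j = b t j) h t j

end flat


/-! ### Polyderivors -/

/-- A polyderivor `(φ, d) : Σ → Λ`: a map `φ` from the sorts of `Σ` to the words on the sorts of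
`Λ`, and maps `d_{w,s} : Σ_{w,s} → T_Λ(↓φ^♯(w))_{φ(s)}`. -/
structure Polyderivor (Sg La : Signature.{u}) where
  sort : Sg.sorts → List La.sorts
  op : ∀ {w : List Sg.sorts} {s : Sg.sorts}, Sg.ops w s →
    Tup (Term La (Var (w.flatMap sort))) (sort s)

namespace Polyderivor

variable {Sg La Om : Signature.{u}}

/-- The algebra `d^* B`: its carrier at `s` is `B_{φ(s)}`, and `σ` operates as the realization of
the terms `d(σ)`. -/
@[reducible] noncomputable def pullback (d : Polyderivor Sg La) (B : Algebra.{u, v} La) :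
    Algebra.{u, max u v} Sg where
  carrier s := Tup B.carrier (d.sort s)
  op σ a := fun t j => B.eval (flat d.sort a) (d.op σ t j)

/-- The homomorphism `d^* f`. -/
def pullbackHom (d : Polyderivor Sg La) {B : Algebra.{u, v} La} {C : Algebra.{u, v'} La}
    (f : B.Hom C) : (d.pullback B).Hom (d.pullback C) where
  map _ a := fun t j => f.map t (a t j)
  map_op σ a := by
    funext t j
    simp only [f.map_eval]
    rfl

/-- The homomorphism `d^♯` from terms for `Σ` to tuples of terms for `Λ`, which sends a variable
`v_i` of `w` with `w_i = s` to the block of variables of `φ^♯(w)` that replaces it. -/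
noncomputable def ext (d : Polyderivor Sg La) {w : List Sg.sorts} {s : Sg.sorts}
    (P : Term Sg (Var w) s) : Tup (Term La (Var (w.flatMap d.sort))) (d.sort s) :=
  (d.pullback (termAlg La (Var (w.flatMap d.sort)))).eval
    (fun _ i _ j => Term.var (Var.join d.sort i j)) P

/-- The identity polyderivor, given by one-letter words and the terms `σ(v_0, …, v_{n-1})`. -/
@[reducible] noncomputable def id (Sg : Signature.{u}) : Polyderivor Sg Sg where
  sort s := [s]
  op σ := single (Term.app σ (fun _ i => Term.var (Var.join (fun s => [s]) i (Var.one _))))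

theorem id_op {w : List Sg.sorts} {s : Sg.sorts} (σ : Sg.ops w s) :
    (id Sg).op σ s (Var.one s) =
      Term.app σ (fun _ i => Term.var (Var.join (fun s => [s]) i (Var.one _))) := rfl

/-- The action of `d^♯` on tuples of terms. -/
noncomputable def map (d : Polyderivor Sg La) {u w : List Sg.sorts} (P : Tup (Term Sg (Var u)) w) :
    Tup (Term La (Var (u.flatMap d.sort))) (w.flatMap d.sort) :=
  flat d.sort (fun s i => d.ext (P s i))

/-- The composite of `d` and `e`: its underlying map of sorts is `ψ^♯ ∘ φ`, and it takes `σ` to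
`e^♯(d(σ))`, where `ψ^♯(φ^♯(w))` is read as `(ψ^♯ ∘ φ)^♯(w)`. -/
@[reducible] noncomputable def comp (d : Polyderivor Sg La) (e : Polyderivor La Om) : Polyderivor Sg Om where
  sort s := (d.sort s).flatMap e.sort
  op σ := fun r k =>
    (e.map (d.op σ) r k).bind (fun _ l => Term.var (l.cast List.flatMap_assoc))

theorem eval_ext (d : Polyderivor Sg La) (B : Algebra.{u, v} La) {w : List Sg.sorts}
    {s : Sg.sorts} (a : Tup (d.pullback B).carrier w) (P : Term Sg (Var w) s) (t : La.sorts)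
    (j : Var (d.sort s) t) :
    B.eval (flat d.sort a) (d.ext P t j) = (d.pullback B).eval a P t j := by
  have h := (d.pullbackHom (B.evalHom (flat d.sort a))).map_eval
    (fun s i t j => Term.var (Var.join d.sort (s := s) i j)) P
  have h := congrFun (congrFun h t) j
  refine h.trans ?_
  refine congrFun (congrFun ?_ t) j
  congr 1
  funext s i t j
  exact (B.eval_var _ _).trans (flat_join a i j)

theorem ext_var (d : Polyderivor Sg La) {w : List Sg.sorts} {s : Sg.sorts} (i : Var w s)
    (t : La.sorts) (j : Var (d.sort s) t) :
    d.ext (Term.var i) t j = Term.var (Var.join d.sort i j) := rfl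

theorem ext_app (d : Polyderivor Sg La) {u w : List Sg.sorts} {s : Sg.sorts} (σ : Sg.ops w s)
    (args : Tup (Term Sg (Var u)) w) (t : La.sorts) (j : Var (d.sort s) t) :
    d.ext (Term.app σ args) t j = (d.op σ t j).bind (flat d.sort fun _ i => d.ext (args _ i)) :=
  rfl

theorem ext_bind (d : Polyderivor Sg La) {u w : List Sg.sorts} {s : Sg.sorts}
    (P : Term Sg (Var w) s) (f : Tup (Term Sg (Var u)) w) (t : La.sorts) (j : Var (d.sort s) t) :
    d.ext (P.bind f) t j = (d.ext P t j).bind (d.map f) := by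
  have := (d.pullback (termAlg La (Var (u.flatMap d.sort)))).eval_bind
    (fun s i t j => Term.var (Var.join d.sort (s := s) i j)) f P
  exact (congrFun (congrFun this t) j).trans (d.eval_ext _ _ P t j).symm

theorem comp_op (d : Polyderivor Sg La) (e : Polyderivor La Om) {w : List Sg.sorts}
    {s : Sg.sorts} (σ : Sg.ops w s) {t : La.sorts} (j : Var (d.sort s) t) {r : Om.sorts}
    (k : Var (e.sort t) r) : (d.comp e).op σ r (Var.join e.sort j k) =
      (e.ext (d.op σ t j) r k).bind (fun _ l => Term.var (l.cast List.flatMap_assoc)) := by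
  have := flat_join (φ := e.sort) (A := Term Om (Var ((w.flatMap d.sort).flatMap e.sort)))
    (fun t j => e.ext (d.op σ t j)) j k
  exact congrArg (Term.bind _) this

theorem comp_ext (d : Polyderivor Sg La) (e : Polyderivor La Om) {w : List Sg.sorts}
    {s : Sg.sorts} (P : Term Sg (Var w) s) :
    (d.comp e).ext P = flat e.sort (fun t j r k =>
      (e.ext (d.ext P t j) r k).bind (fun _ l => Term.var (l.cast List.flatMap_assoc))) := by
  induction P with
  | var i =>
    refine flat_ext fun t j r k => ?_
    rw [flat_join, ext_var, ext_var, ext_var, Term.bind, Algebra.eval_var]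
    exact congrArg _ (Var.join_join _ _ _ _ _ _).symm
  | app σ args ih =>
    refine flat_ext fun t j r k => ?_
    rw [flat_join]
    rw [ext_app, ext_app, ext_bind]
    rw [comp_op, Term.bind_bind, Term.bind_bind]
    congr 1
    refine flat_ext fun t j r k => ?_
    obtain ⟨s, i, j, rfl⟩ := exists_join j
    rw [Polyderivor.map, flat_join, flat_join, Term.var_bind, Var.join_join, flat_join, ih, flat_join]

theorem id_ext {w : List Sg.sorts} {s : Sg.sorts} (P : Term Sg (Var w) s) :
    (Polyderivor.id Sg).ext P =
      single (P.bind fun _ i => Term.var (i.cast (List.flatMap_singleton' w).symm)) := by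
  induction P with
  | var i =>
    refine single_ext ?_
    exact congrArg _ (congrArg (Var.cast (List.flatMap_singleton' w).symm)
      (Var.join_one i (List.flatMap_singleton' w)))
  | app σ args ih =>
    refine single_ext ?_
    rw [ext_app, single_one]
    refine congrArg (Term.app σ) (funext fun t => funext fun i => ?_)
    refine (Algebra.eval_var _ _ _).trans ?_
    exact (flat_join (φ := (Polyderivor.id Sg).sort) _ i (Var.one t)).trans
      ((congrFun (congrFun (ih t i) t) (Var.one t)).trans (single_one _))

end Polyderivor

/-! ### Transformations between polyderivors -/

/-- The extension of a family of tuples of terms `ξ_s`, for the sorts `s`, to words: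
`ξ_w = ξ_{w_0} ∧ ⋯ ∧ ξ_{w_{n-1}}`. -/
noncomputable def wordExt {La : Signature.{u}} {S : Type u} {φ ψ : S → List La.sorts}
    (ξ : ∀ s, Tup (Term La (Var (φ s))) (ψ s)) (w : List S) :
    Tup (Term La (Var (w.flatMap φ))) (w.flatMap ψ) :=
  flat ψ (fun s i t j => (ξ s t j).bind fun _ k => Term.var (Var.join φ i k))

/-- A transformation `ξ : d ⇝ e` of polyderivors: a family of `ξ_s ∈ T_Λ(↓φ(s))_{ψ(s)}` such that
`ξ_s ∘ d(σ) = e(σ) ∘ ξ_w` for all `σ : w → s`. -/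
@[ext]
structure Transformation {Sg La : Signature.{u}} (d e : Polyderivor Sg La) where
  comp : ∀ s, Tup (Term La (Var (d.sort s))) (e.sort s)
  naturality : ∀ {w : List Sg.sorts} {s : Sg.sorts} (σ : Sg.ops w s),
    kcomp (d.op σ) (comp s) = kcomp (wordExt comp w) (e.op σ)

section wordExt

variable {La : Signature.{u}} {S R : Type u}

theorem kcomp_assoc {X : La.sorts → Type v} {Y : La.sorts → Type v'} {Z : La.sorts → Type v''}
    {W : La.sorts → Type*} (P : SMap Y (Term La X)) (Q : SMap Z (Term La Y))
    (N : SMap W (Term La Z)) : kcomp (kcomp P Q) N = kcomp P (kcomp Q N) := by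
  funext s x
  exact (Term.bind_bind _ _ _).symm

theorem kcomp_var {X : La.sorts → Type v} {Y : La.sorts → Type v'} (P : SMap Y (Term La X)) :
    kcomp P (fun _ y => Term.var y) = P := rfl

theorem var_kcomp {X : La.sorts → Type v} {Y : La.sorts → Type v'} (P : SMap Y (Term La X)) :
    kcomp (fun _ x => Term.var x) P = P := by
  funext s x
  exact Term.bind_var _

variable {φ ψ χ : S → List La.sorts}

@[simp] theorem wordExt_join (ξ : ∀ s, Tup (Term La (Var (φ s))) (ψ s)) {w : List S} {s : S}
    (i : Var w s) {t : La.sorts} (j : Var (ψ s) t) :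
    wordExt ξ w t (Var.join ψ i j) = (ξ s t j).bind fun _ k => Term.var (Var.join φ i k) :=
  flat_join _ _ _

theorem wordExt_var (w : List S) :
    wordExt (fun s t (j : Var (φ s) t) => Term.var (Sg := La) j) w = fun _ k => Term.var k :=
  flat_ext fun _ _ _ _ => wordExt_join _ _ _

theorem wordExt_kcomp (ξ : ∀ s, Tup (Term La (Var (φ s))) (ψ s))
    (ζ : ∀ s, Tup (Term La (Var (ψ s))) (χ s)) (w : List S) :
    wordExt (fun s => kcomp (ξ s) (ζ s)) w = kcomp (wordExt ξ w) (wordExt ζ w) := by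
  refine flat_ext fun s i t j => ?_
  rw [wordExt_join, kcomp, kcomp, wordExt_join, Term.bind_bind, Term.bind_bind]
  congr 1
  funext t j
  rw [Term.var_bind, wordExt_join]

theorem wordExt_flatMap (ξ : ∀ s, Tup (Term La (Var (φ s))) (ψ s)) (θ : R → List S) (w : List R)
    {t : La.sorts} (k : Var ((w.flatMap θ).flatMap ψ) t) :
    wordExt (fun r => wordExt ξ (θ r)) w t (k.cast List.flatMap_assoc) =
      (wordExt ξ (w.flatMap θ) t k).bind fun _ l => Term.var (l.cast List.flatMap_assoc) := by
  obtain ⟨s, k, j, rfl⟩ := exists_join k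
  obtain ⟨r, i, k, rfl⟩ := exists_join k
  rw [Var.join_join, wordExt_join, wordExt_join, wordExt_join, Term.bind_bind, Term.bind_bind]
  congr 1
  funext t j
  rw [Term.var_bind, Term.var_bind, Var.join_join]

theorem wordExt_single (ξ : ∀ s, Tup (Term La (Var (φ s))) (ψ s)) (s : S) {t : La.sorts}
    (k : Var ([s].flatMap ψ) t) :
    (wordExt ξ [s] t k).bind (fun _ l => Term.var (l.cast (List.flatMap_singleton _ _))) =
      ξ s t (k.cast (List.flatMap_singleton _ _)) := by
  obtain ⟨s', i, k, rfl⟩ := exists_join k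
  obtain ⟨rfl, -⟩ := Var.eq_one i
  rw [wordExt_join, Term.bind_bind, Var.join_single]
  conv_rhs => rw [← Term.bind_var (ξ s t k)]
  congr 1
  funext t j
  rw [Term.var_bind, Var.join_single]

end wordExt

namespace Polyderivor

variable {Sg La Om : Signature.{u}}

@[simp] theorem map_join (d : Polyderivor Sg La) {u w : List Sg.sorts}
    (P : Tup (Term Sg (Var u)) w) {s : Sg.sorts} (i : Var w s) {t : La.sorts}
    (j : Var (d.sort s) t) : d.map P t (Var.join d.sort i j) = d.ext (P s i) t j :=
  flat_join _ _ _

theorem map_var (d : Polyderivor Sg La) (w : List Sg.sorts) :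
    d.map (fun s (i : Var w s) => Term.var i) = fun _ k => Term.var k :=
  flat_ext fun _ _ _ _ => by rw [map_join, ext_var]

theorem map_cast (d : Polyderivor Sg La) {w w' : List Sg.sorts} (h : w = w') {t : La.sorts}
    (k : Var (w.flatMap d.sort) t) :
    d.map (fun s (i : Var w s) => Term.var (i.cast h)) t k =
      Term.var (k.cast (by rw [h])) := by
  subst h
  exact congrFun (congrFun (d.map_var w) t) k

theorem map_kcomp (d : Polyderivor Sg La) {u v w : List Sg.sorts} (P : Tup (Term Sg (Var u)) v)
    (Q : Tup (Term Sg (Var v)) w) : d.map (kcomp P Q) = kcomp (d.map P) (d.map Q) :=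
  flat_ext fun _ _ _ _ => by rw [map_join, ext_bind, kcomp, map_join]

theorem map_wordExt (h : Polyderivor La Om) {S : Type u} {φ ψ : S → List La.sorts}
    (ξ : ∀ s, Tup (Term La (Var (φ s))) (ψ s)) (w : List S) {r : Om.sorts}
    (k : Var ((w.flatMap ψ).flatMap h.sort) r) :
    wordExt (fun s => h.map (ξ s)) w r (k.cast List.flatMap_assoc) =
      (h.map (wordExt ξ w) r k).bind (fun _ l => Term.var (l.cast List.flatMap_assoc)) := by
  obtain ⟨t, k, l, rfl⟩ := exists_join k
  obtain ⟨s, i, j, rfl⟩ := exists_join k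
  rw [Var.join_join, wordExt_join, map_join, map_join, wordExt_join, ext_bind, Term.bind_bind]
  congr 1
  refine flat_ext fun t j r k => ?_
  rw [map_join, ext_var, Term.var_bind, Var.join_join]

theorem ext_naturality {d e : Polyderivor Sg La} (ξ : Transformation d e) {u : List Sg.sorts}
    {s : Sg.sorts} (P : Term Sg (Var u) s) :
    kcomp (d.ext P) (ξ.comp s) = kcomp (wordExt ξ.comp u) (e.ext P) := by
  induction P with
  | var i =>
    funext t j
    rw [kcomp, kcomp, ext_var, Term.var_bind, wordExt_join]
    rfl
  | @app w s σ args ih =>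
    have h1 : d.ext (Term.app σ args) = kcomp (d.map args) (d.op σ) := rfl
    have h2 : e.ext (Term.app σ args) = kcomp (e.map args) (e.op σ) := rfl
    rw [h1, h2, kcomp_assoc, ξ.naturality, ← kcomp_assoc, ← kcomp_assoc]
    congr 1
    refine flat_ext fun s i t j => ?_
    have := congrFun (congrFun (ih s i) t) j
    rw [kcomp, kcomp, wordExt_join, map_join, Term.bind_bind]
    simp only [Term.var_bind, map_join]
    exact this

theorem map_naturality {d e : Polyderivor Sg La} (ξ : Transformation d e) {u w : List Sg.sorts}
    (P : Tup (Term Sg (Var u)) w) :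
    kcomp (d.map P) (wordExt ξ.comp w) = kcomp (wordExt ξ.comp u) (e.map P) := by
  refine flat_ext fun s i t j => ?_
  have := congrFun (congrFun (ext_naturality ξ (P s i)) t) j
  rw [kcomp, kcomp, wordExt_join, map_join, Term.bind_bind]
  simp only [Term.var_bind, map_join]
  exact this

theorem ext_of_sort {d e : Polyderivor Sg La} (h : ∀ s, d.sort s = e.sort s)
    (hop : ∀ {w : List Sg.sorts} {s : Sg.sorts} (σ : Sg.ops w s) (t : La.sorts)
      (k : Var (d.sort s) t), e.op σ t (k.cast (h s)) =
        (d.op σ t k).bind (fun _ l => Term.var (l.cast (by rw [funext h])))) : d = e := by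
  obtain ⟨φ, d⟩ := d
  obtain ⟨ψ, e⟩ := e
  obtain rfl : φ = ψ := funext h
  congr 1
  funext w s σ t k
  exact ((hop σ t k).trans (Term.bind_var _)).symm

end Polyderivor

/-! ### The 2-category of signatures, polyderivors and transformations -/

namespace Transformation

variable {Sg La Om : Signature.{u}}

/-- The identity transformation, given by the variables. -/
def id (d : Polyderivor Sg La) : Transformation d d where
  comp _ := fun _ i => Term.var i
  naturality σ := by rw [wordExt_var, var_kcomp, kcomp_var]

/-- The vertical composite, with the components `χ_s ∘ ξ_s`. -/
def vcomp {d e h : Polyderivor Sg La} (ξ : Transformation d e) (χ : Transformation e h) :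
    Transformation d h where
  comp s := kcomp (ξ.comp s) (χ.comp s)
  naturality σ := by
    rw [wordExt_kcomp, ← kcomp_assoc, ξ.naturality, kcomp_assoc, χ.naturality, kcomp_assoc]

end Transformation

instance Polyderivor.category (Sg La : Signature.{u}) : Category.{u} (Polyderivor Sg La) where
  Hom d e := Transformation d e
  id d := Transformation.id d
  comp ξ χ := ξ.vcomp χ
  id_comp _ := Transformation.ext (funext fun _ => var_kcomp _)
  comp_id _ := Transformation.ext (funext fun _ => kcomp_var _)
  assoc _ _ _ := Transformation.ext (funext fun _ => kcomp_assoc _ _ _)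

namespace Transformation

variable {Sg La Om : Signature.{u}}

@[ext] theorem hom_ext {d e : Polyderivor Sg La} {ξ χ : d ⟶ e} (h : ∀ s, ξ.comp s = χ.comp s) :
    ξ = χ := Transformation.ext (funext h)

theorem id_comp (d : Polyderivor Sg La) (s : Sg.sorts) :
    Transformation.comp (𝟙 d) s = fun _ i => Term.var i := rfl

theorem comp_comp {d e h : Polyderivor Sg La} (ξ : d ⟶ e) (χ : e ⟶ h) (s : Sg.sorts) :
    Transformation.comp (ξ ≫ χ) s = kcomp (ξ.comp s) (χ.comp s) := rfl

theorem eqToHom_comp {d e : Polyderivor Sg La} (h : d = e) (s : Sg.sorts) :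
    Transformation.comp (eqToHom h) s = fun _ i => Term.var (i.cast (by rw [h])) := by
  cases h; rfl

/-- The horizontal composite of the identity at `d` and of `ξ`, with the components
`ξ_{φ(s)}`. -/
noncomputable def whiskerLeft (d : Polyderivor Sg La) {e h : Polyderivor La Om} (ξ : e ⟶ h) :
    Transformation (d.comp e) (d.comp h) where
  comp s := wordExt ξ.comp (d.sort s)
  naturality {w s} σ := by
    have := Polyderivor.map_naturality ξ (d.op σ)
    funext r k
    have := congrFun (congrFun this r) k
    rw [kcomp, kcomp, Term.bind_bind]
    simp only [Term.var_bind, wordExt_flatMap]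
    rw [← Term.bind_bind, ← Term.bind_bind]
    exact congrArg _ this

/-- The horizontal composite of `ξ` and of the identity at `h`, with the components
`h^♯(ξ_s)`. -/
noncomputable def whiskerRight {d e : Polyderivor Sg La} (ξ : d ⟶ e) (h : Polyderivor La Om) :
    Transformation (d.comp h) (e.comp h) where
  comp s := h.map (ξ.comp s)
  naturality {w s} σ := by
    have := congrArg h.map (ξ.naturality σ)
    rw [Polyderivor.map_kcomp, Polyderivor.map_kcomp] at this
    funext r k
    have := congrFun (congrFun this r) k
    rw [kcomp, kcomp, Term.bind_bind]
    simp only [Term.var_bind, Polyderivor.map_wordExt]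
    rw [← Term.bind_bind, ← Term.bind_bind]
    exact congrArg _ this

end Transformation

namespace Polyderivor

variable {Sg La Om Th : Signature.{u}}

theorem comp_assoc (d : Polyderivor Sg La) (e : Polyderivor La Om) (h : Polyderivor Om Th) :
    (d.comp e).comp h = d.comp (e.comp h) := by
  refine ext_of_sort (fun _ => List.flatMap_assoc) fun {w s} σ r k => ?_
  obtain ⟨t, k, l, rfl⟩ := exists_join k
  obtain ⟨s, i, j, rfl⟩ := exists_join k
  rw [comp_op, comp_op, Var.join_join, ext_bind, Term.bind_bind, Term.bind_bind]
  refine (comp_op d (e.comp h) σ i (Var.join h.sort j l)).trans ?_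
  rw [comp_ext, flat_join, Term.bind_bind]
  congr 1
  funext r l
  rw [map_cast]
  rfl

theorem id_comp' (d : Polyderivor Sg La) : (Polyderivor.id Sg).comp d = d := by
  refine ext_of_sort (fun _ => List.flatMap_singleton _ _) fun {w s} σ r k => ?_
  obtain ⟨t, k, l, rfl⟩ := exists_join k
  obtain ⟨e, hk⟩ := Var.eq_one k
  subst e
  obtain rfl : k = Var.one _ := hk
  rw [Var.join_single, comp_op, Term.bind_bind, id_op, ext_app, Term.bind_bind]
  conv_lhs => rw [← Term.bind_var (d.op σ r l)]
  congr 1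
  refine flat_ext fun s i t j => ?_
  rw [flat_join, ext_var, Term.var_bind, Term.var_bind]
  exact congrArg Term.var (Var.ext (congrArg Var.pos (Var.join_unit_join (φ := d.sort) i j)).symm)

theorem comp_id' (d : Polyderivor Sg La) : d.comp (Polyderivor.id La) = d := by
  refine ext_of_sort (fun _ => List.flatMap_singleton' _) fun {w s} σ r k => ?_
  obtain ⟨t, k, l, rfl⟩ := exists_join k
  obtain ⟨e, hl⟩ := Var.eq_one l
  subst e
  obtain rfl : l = Var.one _ := hl
  rw [Var.join_one, comp_op, id_ext, Term.bind_bind, single_one, Term.bind_bind]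
  conv_lhs => rw [← Term.bind_var (d.op σ _ k)]
  congr 1

end Polyderivor

namespace Transformation

open Polyderivor

variable {Sg La Om Th : Signature.{u}}

theorem id_whiskerLeft {d e : Polyderivor Sg La} (ξ : d ⟶ e) :
    whiskerLeft (Polyderivor.id Sg) ξ =
      eqToHom (id_comp' d) ≫ ξ ≫ eqToHom (id_comp' e).symm := by
  refine hom_ext fun s => ?_
  rw [comp_comp, comp_comp, eqToHom_comp, eqToHom_comp]
  funext t k
  have h := wordExt_single ξ.comp s k
  refine Eq.trans ?_ (congrArg (Term.bind fun _ l =>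
    Term.var (l.cast (List.flatMap_singleton d.sort s).symm)) h)
  rw [Term.bind_bind]
  exact (Term.bind_var _).symm

theorem whiskerRight_id {d e : Polyderivor Sg La} (ξ : d ⟶ e) :
    whiskerRight ξ (Polyderivor.id La) =
      eqToHom (comp_id' d) ≫ ξ ≫ eqToHom (comp_id' e).symm := by
  refine hom_ext fun s => ?_
  rw [comp_comp, comp_comp, eqToHom_comp, eqToHom_comp]
  refine flat_ext fun t k r l => ?_
  obtain ⟨h, hl⟩ := Var.eq_one l
  subst h
  obtain rfl : l = Var.one _ := hl
  have : (whiskerRight ξ (Polyderivor.id La)).comp s t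
      (Var.join (Polyderivor.id La).sort k (Var.one t)) = _ := map_join _ _ _ _
  rw [this, id_ext, single_one]
  exact congrArg (Term.bind _) (congrArg (ξ.comp s t)
    (Var.join_one k (List.flatMap_singleton' (e.sort s))).symm)

theorem comp_whiskerLeft (d : Polyderivor Sg La) (e : Polyderivor La Om) {h h' : Polyderivor Om Th}
    (ξ : h ⟶ h') : whiskerLeft (d.comp e) ξ = eqToHom (comp_assoc d e h) ≫
      whiskerLeft d (whiskerLeft e ξ) ≫ eqToHom (comp_assoc d e h').symm := by
  refine hom_ext fun s => ?_
  rw [comp_comp, comp_comp, eqToHom_comp, eqToHom_comp]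
  funext t k
  have := wordExt_flatMap ξ.comp e.sort (d.sort s) k
  refine Eq.trans ?_ (congrArg (Term.bind fun _ l =>
    Term.var (l.cast (List.flatMap_assoc (f := e.sort) (g := h.sort)).symm)) this.symm)
  rw [Term.bind_bind]
  exact (Term.bind_var _).symm

theorem whiskerRight_comp {d d' : Polyderivor Sg La} (ξ : d ⟶ d') (e : Polyderivor La Om)
    (h : Polyderivor Om Th) : whiskerRight ξ (e.comp h) = eqToHom (comp_assoc d e h).symm ≫
      whiskerRight (whiskerRight ξ e) h ≫ eqToHom (comp_assoc d' e h) := by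
  refine hom_ext fun s => ?_
  rw [comp_comp, comp_comp, eqToHom_comp, eqToHom_comp]
  refine flat_ext fun t i r k => ?_
  obtain ⟨o, j, k, rfl⟩ := exists_join k
  have h1 : (whiskerRight ξ (e.comp h)).comp s r
    (Var.join (e.comp h).sort i (Var.join h.sort j k)) = _ := map_join _ _ _ _
  rw [h1, comp_ext, flat_join, ← map_join e (ξ.comp s) i j, ← map_join h _ (Var.join e.sort i j) k]
  refine congrArg (Term.bind _) (congrArg _ ?_)
  rw [← Var.join_join (h := List.flatMap_assoc)]
  rfl

theorem whisker_assoc (d : Polyderivor Sg La) {e e' : Polyderivor La Om} (ξ : e ⟶ e')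
    (h : Polyderivor Om Th) : whiskerRight (whiskerLeft d ξ) h = eqToHom (comp_assoc d e h) ≫
      whiskerLeft d (whiskerRight ξ h) ≫ eqToHom (comp_assoc d e' h).symm := by
  refine hom_ext fun s => ?_
  rw [comp_comp, comp_comp, eqToHom_comp, eqToHom_comp]
  funext r k
  have := map_wordExt h ξ.comp (d.sort s) k
  refine Eq.trans ?_ (congrArg (Term.bind fun _ l =>
    Term.var (l.cast (List.flatMap_assoc (f := e.sort) (g := h.sort)).symm)) this.symm)
  rw [Term.bind_bind]
  exact (Term.bind_var _).symm

theorem whiskerRight_eqToHom {d e : Polyderivor Sg La} (h : d = e) (k : Polyderivor La Om) :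
    whiskerRight (eqToHom h) k = eqToHom (congrArg (fun d => d.comp k) h) := by
  subst h
  exact hom_ext fun s => map_var _ _

theorem whiskerLeft_eqToHom (k : Polyderivor Sg La) {d e : Polyderivor La Om} (h : d = e) :
    whiskerLeft k (eqToHom h) = eqToHom (congrArg (fun d => k.comp d) h) := by
  subst h
  exact hom_ext fun s => wordExt_var _

end Transformation

open Polyderivor in
/-- The 2-category of signatures, polyderivors and transformations. -/
noncomputable instance sigPd : Bicategory Signature.{u} where
  Hom Sg La := Polyderivor Sg La
  id Sg := Polyderivor.id Sg
  comp d e := d.comp e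
  homCategory Sg La := Polyderivor.category Sg La
  whiskerLeft d _ _ ξ := Transformation.whiskerLeft d ξ
  whiskerRight ξ h := Transformation.whiskerRight ξ h
  associator d e h := eqToIso (comp_assoc d e h)
  leftUnitor d := eqToIso (id_comp' d)
  rightUnitor d := eqToIso (comp_id' d)
  whiskerLeft_id _ _ := Transformation.hom_ext fun _ => wordExt_var _
  whiskerLeft_comp _ _ _ _ _ _ := Transformation.hom_ext fun _ => wordExt_kcomp _ _ _
  id_whiskerLeft ξ := Transformation.id_whiskerLeft ξ
  comp_whiskerLeft d e _ _ ξ := Transformation.comp_whiskerLeft d e ξ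
  id_whiskerRight _ _ := Transformation.hom_ext fun _ => map_var _ _
  comp_whiskerRight _ _ _ := Transformation.hom_ext fun _ => map_kcomp _ _ _
  whiskerRight_id ξ := Transformation.whiskerRight_id ξ
  whiskerRight_comp ξ e h := Transformation.whiskerRight_comp ξ e h
  whisker_assoc d _ _ ξ h := Transformation.whisker_assoc d ξ h
  whisker_exchange ξ χ := Transformation.hom_ext fun s => (map_naturality χ (ξ.comp s)).symm
  pentagon d e h k := by
    simp only [eqToIso.hom, Transformation.whiskerRight_eqToHom,
      Transformation.whiskerLeft_eqToHom, eqToHom_trans]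
  triangle d e := by
    simp only [eqToIso.hom, Transformation.whiskerRight_eqToHom,
      Transformation.whiskerLeft_eqToHom, eqToHom_trans]

instance : Bicategory.Strict Signature.{u} where
  id_comp d := Polyderivor.id_comp' d
  comp_id d := Polyderivor.comp_id' d
  assoc d e h := Polyderivor.comp_assoc d e h
  leftUnitor_eqToIso _ := rfl
  rightUnitor_eqToIso _ := rfl
  associator_eqToIso _ _ _ := rfl

/-! ### Pseudofunctors, pseudo-extranatural transformations and 2-institutions -/

/-- The data of a pseudofunctor: its action on objects, 1-cells and 2-cells, and its structural
isomorphisms. -/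
structure PseudofunctorData (B : Type*) [Bicategory B] (C : Type*) [Bicategory C] extends
    PrelaxFunctorStruct B C where
  mapId (a : B) : map (𝟙 a) ≅ 𝟙 (obj a)
  mapComp {a b c : B} (f : a ⟶ b) (g : b ⟶ c) : map (f ≫ g) ≅ map f ≫ map g

/-- The data that underlie a pseudofunctor. -/
def PseudofunctorData.ofPseudofunctor {B : Type*} [Bicategory B] {C : Type*} [Bicategory C]
    (P : Pseudofunctor B C) : PseudofunctorData B C where
  toPrelaxFunctorStruct := P.toPrelaxFunctorStruct
  mapId := P.mapId
  mapComp := P.mapComp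

/-- The data are those of a pseudofunctor, i.e. the action on 2-cells is functorial, and the
structural isomorphisms are natural and satisfy the associativity and unit coherence axioms. -/
def PseudofunctorData.IsPseudofunctor {B : Type*} [Bicategory B] {C : Type*} [Bicategory C]
    (F : PseudofunctorData B C) : Prop :=
  ∃ P : Pseudofunctor B C, PseudofunctorData.ofPseudofunctor P = F

/-- The product `F(·) × G(·)` of two `Cat`-valued pseudofunctors, on the product of their domains. -/
def PseudofunctorData.times {B : Type*} [Bicategory B] {C : Type*} [Bicategory C]
    (F : PseudofunctorData B Cat.{v, v'}) (G : PseudofunctorData C Cat.{v, v'}) :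
    PseudofunctorData (B × C) Cat.{v, v'} where
  obj c := Cat.of (F.obj c.1 × G.obj c.2)
  map f := ((F.map f.1).toFunctor.prod (G.map f.2).toFunctor).toCatHom
  map₂ η := (NatTrans.prod (F.map₂ η.1).toNatTrans (G.map₂ η.2).toNatTrans).toCatHom₂
  mapId c := Cat.Hom.isoMk (NatIso.ofComponents (fun X => Iso.prod
      ((Cat.Hom.toNatIso (F.mapId c.1)).app X.1) ((Cat.Hom.toNatIso (G.mapId c.2)).app X.2))
    (fun f => Prod.ext ((F.mapId c.1).hom.toNatTrans.naturality f.1)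
      ((G.mapId c.2).hom.toNatTrans.naturality f.2)))
  mapComp f g := Cat.Hom.isoMk (NatIso.ofComponents (fun X => Iso.prod
      ((Cat.Hom.toNatIso (F.mapComp f.1 g.1)).app X.1)
      ((Cat.Hom.toNatIso (G.mapComp f.2 g.2)).app X.2))
    (fun h => Prod.ext ((F.mapComp f.1 g.1).hom.toNatTrans.naturality h.1)
      ((G.mapComp f.2 g.2).hom.toNatTrans.naturality h.2)))

section extranatural

open Bicategory Bicategory.Opposite

variable {C : Type*} [Bicategory C] {D : Type*} [Bicategory D]

/-- For `F` on `Cᵒᵖ × C`, the 1-cell `F(f, 1) : F(c', x) ⟶ F(c, x)` for `f : c ⟶ c'`. -/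
abbrev PseudofunctorData.left (F : PseudofunctorData (Cᵒᵖ × C) D) {c c' : C} (f : c ⟶ c') (x : C) :
    F.obj (op c', x) ⟶ F.obj (op c, x) :=
  F.map (X := (op c', x)) (Y := (op c, x)) (f.op, 𝟙 x)

/-- For `F` on `Cᵒᵖ × C`, the 1-cell `F(1, f) : F(x, c) ⟶ F(x, c')` for `f : c ⟶ c'`. -/
abbrev PseudofunctorData.right (F : PseudofunctorData (Cᵒᵖ × C) D) (x : C) {c c' : C}
    (f : c ⟶ c') : F.obj (op x, c) ⟶ F.obj (op x, c') :=
  F.map (X := (op x, c)) (Y := (op x, c')) (𝟙 (op x), f)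

/-- The 2-cell `F(ξ, 1) : F(f, 1) ⟶ F(g, 1)` for `ξ : f ⟶ g`. -/
abbrev PseudofunctorData.left₂ (F : PseudofunctorData (Cᵒᵖ × C) D) {c c' : C} {f g : c ⟶ c'}
    (ξ : f ⟶ g) (x : C) : F.left f x ⟶ F.left g x :=
  F.map₂ (a := (op c', x)) (b := (op c, x)) (f := (f.op, 𝟙 x)) (g := (g.op, 𝟙 x)) (op2 ξ, 𝟙 (𝟙 x))

/-- The 2-cell `F(1, ξ) : F(1, f) ⟶ F(1, g)` for `ξ : f ⟶ g`. -/
abbrev PseudofunctorData.right₂ (F : PseudofunctorData (Cᵒᵖ × C) D) (x : C) {c c' : C}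
    {f g : c ⟶ c'} (ξ : f ⟶ g) : F.right x f ⟶ F.right x g :=
  F.map₂ (a := (op x, c)) (b := (op x, c')) (f := (𝟙 (op x), f)) (g := (𝟙 (op x), g))
    (𝟙 (𝟙 (op x)), ξ)

/-- The 2-cell `F(g ∘ f, 1) ⟶ F(f, 1) ∘ F(g, 1)` given by the structure of `F`. -/
def PseudofunctorData.leftComp (F : PseudofunctorData (Cᵒᵖ × C) D) {a b c : C} (f : a ⟶ b)
    (g : b ⟶ c) (x : C) : F.left (f ≫ g) x ⟶ F.left g x ≫ F.left f x :=
  F.map₂ (a := (op c, x)) (b := (op a, x)) (f := ((f ≫ g).op, 𝟙 x))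
      (g := (g.op ≫ f.op, 𝟙 x ≫ 𝟙 x)) (𝟙 (f ≫ g).op, (λ_ (𝟙 x)).inv) ≫
    (F.mapComp (a := (op c, x)) (b := (op b, x)) (c := (op a, x)) (g.op, 𝟙 x) (f.op, 𝟙 x)).hom

/-- The 2-cell `F(1, g) ∘ F(1, f) ⟶ F(1, g ∘ f)` given by the structure of `F`. -/
def PseudofunctorData.rightComp (F : PseudofunctorData (Cᵒᵖ × C) D) (x : C) {a b c : C}
    (f : a ⟶ b) (g : b ⟶ c) : F.right x f ≫ F.right x g ⟶ F.right x (f ≫ g) :=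
  (F.mapComp (a := (op x, a)) (b := (op x, b)) (c := (op x, c)) (𝟙 (op x), f) (𝟙 (op x), g)).inv ≫
    F.map₂ (a := (op x, a)) (b := (op x, c)) (f := (𝟙 (op x) ≫ 𝟙 (op x), f ≫ g))
      (g := (𝟙 (op x), f ≫ g)) ((λ_ (𝟙 (op x))).hom, 𝟙 (f ≫ g))

/-- The 2-cell `F(1, f) ∘ F(g, 1) ⟶ F(g, 1) ∘ F(1, f)` given by the structure of `F`; both of them
are isomorphic to `F(g, f)`. -/
def PseudofunctorData.exchange (F : PseudofunctorData (Cᵒᵖ × C) D) {a a' b b' : C} (f : a ⟶ a')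
    (g : b ⟶ b') : F.left g a ≫ F.right b f ⟶ F.right b' f ≫ F.left g a' :=
  (F.mapComp (a := (op b', a)) (b := (op b, a)) (c := (op b, a')) (g.op, 𝟙 a) (𝟙 (op b), f)).inv ≫
    F.map₂ (a := (op b', a)) (b := (op b, a')) (f := (g.op ≫ 𝟙 (op b), 𝟙 a ≫ f))
      (g := (𝟙 (op b') ≫ g.op, f ≫ 𝟙 a'))
      ((ρ_ g.op).hom ≫ (λ_ g.op).inv, (λ_ f).hom ≫ (ρ_ f).inv) ≫
    (F.mapComp (a := (op b', a)) (b := (op b', a')) (c := (op b, a')) (𝟙 (op b'), f)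
      (g.op, 𝟙 a')).hom

/-- The data of a pseudo-extranatural transformation from `F : Cᵒᵖ × C ⥤ D` to the constant functor
at `d`: 1-cells `α_c : F(c, c) ⟶ d` and invertible 2-cells `β_f : α_c ∘ F(f, 1) ⟶ α_{c'} ∘ F(1, f)`
for `f : c ⟶ c'`. -/
structure ExtranaturalData (F : PseudofunctorData (Cᵒᵖ × C) D) (d : D) where
  app (c : C) : F.obj (op c, c) ⟶ d
  iso {c c' : C} (f : c ⟶ c') : F.left f c ≫ app c ≅ F.right c' f ≫ app c'

/-- The axioms of a pseudo-extranatural transformation from `F` to the constant functor at `d`: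
compatibility with 2-cells, with composites and with identities. -/
structure ExtranaturalData.IsPseudoExtranatural {F : PseudofunctorData (Cᵒᵖ × C) D} {d : D}
    (T : ExtranaturalData F d) : Prop where
  naturality : ∀ {c c' : C} {f g : c ⟶ c'} (ξ : f ⟶ g),
    F.left₂ ξ c ▷ T.app c ≫ (T.iso g).hom = (T.iso f).hom ≫ F.right₂ c' ξ ▷ T.app c'
  iso_comp : ∀ {a b c : C} (f : a ⟶ b) (g : b ⟶ c),
    (T.iso (f ≫ g)).hom =
      F.leftComp f g a ▷ T.app a ≫ (α_ (F.left g a) (F.left f a) (T.app a)).hom ≫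
      F.left g a ◁ (T.iso f).hom ≫
      (α_ (F.left g a) (F.right b f) (T.app b)).inv ≫ F.exchange f g ▷ T.app b ≫
      (α_ (F.right c f) (F.left g b) (T.app b)).hom ≫
      F.right c f ◁ (T.iso g).hom ≫
      (α_ (F.right c f) (F.right c g) (T.app c)).inv ≫ F.rightComp c f g ▷ T.app c
  iso_id : ∀ c : C,
    (F.mapId (op c, c)).inv ▷ T.app c ≫ (T.iso (𝟙 c)).hom = (F.mapId (op c, c)).inv ▷ T.app c

end extranatural

/-- `(Sig, Mod, Sen, (α, β))` is a 2-institution on the category `C`: `Sig` is a 2-category,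
`Mod : Sigᵒᵖ ⥤ Cat` and `Sen : Sig ⥤ Cat` are pseudofunctors, and `(α, β)` is a pseudo-extranatural
transformation from `Mod(·) × Sen(·)` to the constant functor at `C`. -/
structure IsTwoInstitution (Sig : Type*) [Bicategory Sig] [Bicategory.Strict Sig]
    (Mod : PseudofunctorData Sigᵒᵖ Cat.{v, v'}) (Sen : PseudofunctorData Sig Cat.{v, v'})
    (C : Cat.{v, v'}) (T : ExtranaturalData (Mod.times Sen) C) : Prop where
  mod : Mod.IsPseudofunctor
  sen : Sen.IsPseudofunctor
  extranatural : T.IsPseudoExtranatural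

/-! ### Algebras -/

instance algebraCategory (Sg : Signature.{u}) : Category.{u} (Algebra.{u, u} Sg) where
  Hom A B := A.Hom B
  id A := ⟨fun _ a => a, fun _ _ => rfl⟩
  comp f g := ⟨fun s a => g.map s (f.map s a), fun σ a => by rw [f.map_op, g.map_op]⟩

section alg

variable {Sg La Om : Signature.{u}}

@[ext] theorem Algebra.hom_ext {A B : Algebra.{u, u} Sg} {f g : A ⟶ B}
    (h : ∀ s a, f.map s a = g.map s a) : f = g :=
  Algebra.Hom.ext (funext fun s => funext fun a => h s a)

/-- The functor `d^* : Alg(Λ) ⥤ Alg(Σ)`. -/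
noncomputable def Polyderivor.pullbackFunctor (d : Polyderivor Sg La) :
    Algebra.{u, u} La ⥤ Algebra.{u, u} Sg where
  obj B := d.pullback B
  map f := d.pullbackHom f

/-- The component at `B` of the natural transformation given by `ξ`: at `s` it is the realization
`B_{φ(s)} → B_{ψ(s)}` of the terms `ξ_s`. -/
noncomputable def Transformation.realize {d e : Polyderivor Sg La} (ξ : Transformation d e)
    (B : Algebra.{u, v} La) : (d.pullback B).Hom (e.pullback B) where
  map s a := fun t j => B.eval a (ξ.comp s t j)
  map_op {w s} σ a := by
    funext t j
    have := congrArg (B.eval (flat d.sort a)) (congrFun (congrFun (ξ.naturality σ) t) j)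
    simp only [kcomp, Algebra.eval_bind] at this
    refine this.trans ?_
    refine congrArg (fun b => B.eval b (e.op σ t j)) ?_
    refine flat_ext fun s i t j => ?_
    rw [wordExt_join, flat_join, Algebra.eval_bind]
    refine congrArg (fun b => B.eval b (ξ.comp s t j)) ?_
    funext t j
    rw [Algebra.eval_var, flat_join]

/-- The natural transformation `d^* ⟶ e^*` given by `ξ`. -/
noncomputable def Transformation.realizeNatTrans {d e : Polyderivor Sg La}
    (ξ : Transformation d e) : d.pullbackFunctor ⟶ e.pullbackFunctor where
  app B := ξ.realize B
  naturality B C f := Algebra.hom_ext fun s a => by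
    funext t j
    exact (f.map_eval a (ξ.comp s t j)).symm

/-- `B_{(s)} ≅ B_s`, as an isomorphism of algebras. -/
noncomputable def pullbackId (B : Algebra.{u, u} Sg) : (Polyderivor.id Sg).pullback B ≅ B where
  hom :=
    { map := fun s a => a s (Var.one s)
      map_op := fun σ a => by
        refine congrArg (B.op σ) ?_
        funext s i
        exact flat_join _ _ _ }
  inv :=
    { map := fun s a => single a
      map_op := fun σ a => by
        refine single_ext ?_
        refine congrArg (B.op σ) ?_
        funext s i
        exact (flat_join (φ := fun s => [s]) (fun s i => single (a s i)) i (Var.one s)).symm }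
  hom_inv_id := Algebra.hom_ext fun s a => single_ext rfl
  inv_hom_id := Algebra.hom_ext fun s a => rfl

theorem flat_unflat {S T : Type u} {φ : S → List T} {A : T → Type v} {w : List S}
    (a : Tup A (w.flatMap φ)) : flat φ (fun _ i t j => a t (Var.join φ i j)) = a :=
  flat_ext fun _ _ _ _ => flat_join _ _ _

theorem unflat_flat {S T : Type u} {φ : S → List T} {A : T → Type v} {w : List S}
    (a : ∀ s, Var w s → Tup A (φ s)) : (fun s (i : Var w s) t (j : Var (φ s) t) =>
      flat φ a t (Var.join φ i j)) = a := by
  funext s i t j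
  exact flat_join _ _ _

theorem pullback_comp_op (d : Polyderivor Sg La) (e : Polyderivor La Om) (B : Algebra.{u, v} Om)
    {w : List Sg.sorts} {s : Sg.sorts} (σ : Sg.ops w s)
    (a : Tup (d.pullback (e.pullback B)).carrier w) :
    ((d.comp e).pullback B).op σ (fun s i => flat e.sort (a s i)) =
      flat e.sort ((d.pullback (e.pullback B)).op σ a) := by
  refine flat_ext fun t j r k => ?_
  rw [flat_join]
  refine (congrArg (B.eval _) (d.comp_op e σ j k)).trans ?_
  rw [Algebra.eval_bind]
  refine Eq.trans ?_ (e.eval_ext B (flat d.sort a) (d.op σ t j) r k)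
  congr 1
  refine flat_ext fun t j r k => ?_
  obtain ⟨s, i, j, rfl⟩ := exists_join j
  rw [flat_join, flat_join, Algebra.eval_var, Var.join_join, flat_join, flat_join]

/-- The isomorphism of algebras `(e ∘ d)^* B ≅ d^* (e^* B)`, given by
`B_{ψ^♯(φ(s))} ≅ ∏_i B_{ψ(φ(s)_i)}`. -/
noncomputable def pullbackComp (d : Polyderivor Sg La) (e : Polyderivor La Om)
    (B : Algebra.{u, u} Om) : (d.comp e).pullback B ≅ d.pullback (e.pullback B) where
  hom :=
    { map := fun s a => fun t j r k => a r (Var.join e.sort j k)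
      map_op := fun {w s} σ a => by
        have h := pullback_comp_op d e B σ (fun s i t j r k => a s i r (Var.join e.sort j k))
        have h' : (fun s i => flat e.sort
            ((fun s i t j r k => a s i r (Var.join e.sort j k) :
              Tup (d.pullback (e.pullback B)).carrier w) s i)) = a := by
          funext s i
          exact flat_unflat _
        rw [h'] at h
        refine Eq.trans ?_ (unflat_flat _)
        rw [← h] }
  inv :=
    { map := fun s a => flat e.sort a
      map_op := fun σ a => (pullback_comp_op d e B σ a).symm }
  hom_inv_id := Algebra.hom_ext fun s a => flat_unflat _
  inv_hom_id := Algebra.hom_ext fun s a => unflat_flat _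

end alg

/-- The data of the pseudofunctor `Alg_pd`: it takes `Σ` to `Alg(Σ)`, a polyderivor `d` to `d^*`
and a transformation `ξ` to the realizations of the terms `ξ_s`; its structural isomorphisms are
`B_{(s)} ≅ B_s` and `B_{ψ^♯(φ(s))} ≅ ∏_i B_{ψ(φ(s)_i)}`. -/
noncomputable def algPd : PseudofunctorData Signature.{u}ᵒᵖ Cat.{u, u + 1} where
  obj Sg := Cat.of (Algebra.{u, u} Sg.unop)
  map d := (Polyderivor.pullbackFunctor d.unop).toCatHom
  map₂ ξ := (Transformation.realizeNatTrans ξ.unop2).toCatHom₂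
  mapId Sg := Cat.Hom.isoMk (NatIso.ofComponents (fun B => pullbackId B))
  mapComp d e := Cat.Hom.isoMk (NatIso.ofComponents (fun B => pullbackComp e.unop d.unop B))

/-! ### Terms -/

/-- The objects of the category of terms `Ter(Σ)`: families of sets of variables. -/
structure Ter (Sg : Signature.{u}) where
  family : Sg.sorts → Type u

/-- The category `Ter(Σ)`: the dual of the Kleisli category of the monad `T_Σ`. A morphism from
`X` to `Y` is a sorted map `Y → T_Σ(X)`, and the composite of `P` and `Q` is `P^♯ ∘ Q`. -/
instance terCategory (Sg : Signature.{u}) : Category.{u} (Ter Sg) where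
  Hom X Y := SMap Y.family (Term Sg X.family)
  id _ := fun _ x => Term.var x
  comp P Q := kcomp P Q
  id_comp P := var_kcomp P
  comp_id P := kcomp_var P
  assoc P Q N := kcomp_assoc P Q N

namespace Polyderivor

variable {Sg La Om : Signature.{u}}

/-- `∐^†_φ X`: the family of the sets `{(x, s, φ(s), j) | x ∈ X_s, φ(s)_j = t}`. -/
def copr (d : Polyderivor Sg La) (X : Sg.sorts → Type v) (t : La.sorts) : Type (max u v) :=
  Σ s : Sg.sorts, X s × Var (d.sort s) t

/-- The `Σ`-homomorphism `η^d_X : T_Σ(X) → d^*(T_Λ(∐^†_φ X))` that extends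
`x ↦ ((x, s, φ(s), i))_i`. -/
noncomputable def translate (d : Polyderivor Sg La) {X : Sg.sorts → Type v} {s : Sg.sorts}
    (P : Term Sg X s) : Tup (Term La (d.copr X)) (d.sort s) :=
  (d.pullback (termAlg La (d.copr X))).eval (fun s x _ j => Term.var ⟨s, x, j⟩) P

/-- The bijection between sorted maps `X → d^* A` and sorted maps `∐^†_φ X → A`. -/
def transpose (d : Polyderivor Sg La) (X : Sg.sorts → Type v) (A : La.sorts → Type v') :
    SMap X (fun s => Tup A (d.sort s)) ≃ SMap (d.copr X) A where
  toFun f := fun t p => f p.1 p.2.1 t p.2.2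
  invFun g := fun s x t j => g t ⟨s, x, j⟩
  left_inv _ := rfl
  right_inv _ := rfl

theorem eval_translate (d : Polyderivor Sg La) {X : Sg.sorts → Type v} (A : Algebra.{u, v'} La)
    (f : SMap X (d.pullback A).carrier) {s : Sg.sorts} (P : Term Sg X s) (t : La.sorts)
    (j : Var (d.sort s) t) :
    A.eval (d.transpose X A.carrier f) (d.translate P t j) = (d.pullback A).eval f P t j := by
  have h := (d.pullbackHom (A.evalHom (d.transpose X A.carrier f))).map_eval
    (fun s x t j => Term.var (⟨s, x, j⟩ : d.copr X t)) P
  exact congrFun (congrFun h t) j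

theorem translate_naturality {d e : Polyderivor Sg La} (ξ : Transformation d e)
    {X : Sg.sorts → Type v} {s : Sg.sorts} (P : Term Sg X s) (t : La.sorts)
    (j : Var (e.sort s) t) :
    (ξ.comp s t j).bind (d.translate P) = (e.translate P t j).bind
      (fun t p => (ξ.comp p.1 t p.2.2).bind fun _ k => Term.var ⟨p.1, p.2.1, k⟩) := by
  have h := (ξ.realize (termAlg La (d.copr X))).map_eval (fun s x _ j => Term.var ⟨s, x, j⟩) P
  exact (congrFun (congrFun h t) j).trans
    (e.eval_translate (termAlg La (d.copr X)) _ P t j).symm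

theorem translate_bind (d : Polyderivor Sg La) {X : Sg.sorts → Type v} {Y : Sg.sorts → Type v'}
    (f : SMap X (Term Sg Y)) {s : Sg.sorts} (P : Term Sg X s) (t : La.sorts)
    (j : Var (d.sort s) t) : d.translate (P.bind f) t j = (d.translate P t j).bind
      (d.transpose X _ (fun s x => d.translate (f s x))) :=
  (congrFun (congrFun ((d.pullback (termAlg La (d.copr Y))).eval_bind
    (fun s x _ j => Term.var ⟨s, x, j⟩) f P) t) j).trans
    (d.eval_translate (termAlg La (d.copr Y)) (fun s y => d.translate (f s y)) P t j).symm

theorem translate_id {X : Sg.sorts → Type u} {s : Sg.sorts} (P : Term Sg X s) :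
    (Polyderivor.id Sg).translate P s (Var.one s) =
      P.bind (fun t x => Term.var (⟨t, x, Var.one t⟩ : (Polyderivor.id Sg).copr X t)) :=
  (pullbackId (termAlg Sg ((Polyderivor.id Sg).copr X))).hom.map_eval
    (fun s x _ j => Term.var ⟨s, x, j⟩) P

theorem translate_comp (d : Polyderivor Sg La) (e : Polyderivor La Om) {X : Sg.sorts → Type u}
    {s : Sg.sorts} (P : Term Sg X s) {t : La.sorts} (j : Var (d.sort s) t) {r : Om.sorts}
    (k : Var (e.sort t) r) : (d.comp e).translate P r (Var.join e.sort j k) =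
      (e.translate (d.translate P t j) r k).bind (fun r p => Term.var
        (⟨p.2.1.1, p.2.1.2.1, Var.join e.sort p.2.1.2.2 p.2.2⟩ : (d.comp e).copr X r)) := by
  have h := (pullbackComp d e (termAlg Om ((d.comp e).copr X))).hom.map_eval
    (fun s x _ j => Term.var ⟨s, x, j⟩) P
  have h := congrFun (congrFun (congrFun (congrFun h t) j) r) k
  refine h.trans ?_
  have h1 := d.eval_translate (e.pullback (termAlg Om ((d.comp e).copr X)))
    (fun s x t j r k => Term.var (⟨s, x, Var.join e.sort j k⟩ : (d.comp e).copr X r)) P t j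
  exact (congrFun (congrFun h1 r) k).symm.trans (e.eval_translate _ _ _ r k).symm

/-- The functor `d_⋄ : Ter(Σ) ⥤ Ter(Λ)`. -/
noncomputable def terFunctor (d : Polyderivor Sg La) : Ter Sg ⥤ Ter La where
  obj X := ⟨d.copr X.family⟩
  map {_ Y} P := d.transpose Y.family _ (fun s y => d.translate (P s y))
  map_id _ := rfl
  map_comp P Q := by
    funext t p
    exact d.translate_bind P (Q p.1 p.2.1) t p.2.2

end Polyderivor

section ter

variable {Sg La Om : Signature.{u}}

/-- The component at `X` of the natural transformation given by `ξ`: it takes the variable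
`(x, s, ψ(s), j)` to the term `(ξ_s)_j`, where the variables `v_k` of `φ(s)` are replaced by
`(x, s, φ(s), k)`. -/
def Transformation.ter {d e : Polyderivor Sg La} (ξ : Transformation d e)
    (X : Sg.sorts → Type v) : SMap (e.copr X) (Term La (d.copr X)) :=
  fun t p => (ξ.comp p.1 t p.2.2).bind fun _ k => Term.var ⟨p.1, p.2.1, k⟩

/-- The natural transformation `d_⋄ ⟶ e_⋄` given by `ξ`. -/
noncomputable def Transformation.terNatTrans {d e : Polyderivor Sg La} (ξ : Transformation d e) :
    d.terFunctor ⟶ e.terFunctor where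
  app X := ξ.ter X.family
  naturality _ _ P := by
    funext t p
    exact (Term.bind_bind _ _ _).trans (Polyderivor.translate_naturality ξ (P p.1 p.2.1) t p.2.2)

/-- The isomorphism between `∐^†_φ X`, for the identity polyderivor, and `X`. -/
def terId (X : Ter Sg) : (Polyderivor.id Sg).terFunctor.obj X ≅ X where
  hom := fun s x => Term.var (⟨s, x, Var.one s⟩ : (Polyderivor.id Sg).copr X.family s)
  inv := fun t p => single (A := Term Sg X.family) (Term.var p.2.1) t p.2.2
  hom_inv_id := by
    funext t p
    obtain ⟨s, x, j⟩ := p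
    obtain ⟨h, hj⟩ := Var.eq_one j
    subst h
    obtain rfl : j = Var.one _ := hj
    rfl
  inv_hom_id := rfl

/-- The isomorphism between `∐^†_{ψ^♯ ∘ φ} X` and `∐^†_ψ ∐^†_φ X`. -/
noncomputable def terComp (d : Polyderivor Sg La) (e : Polyderivor La Om) (X : Ter Sg) :
    (d.comp e).terFunctor.obj X ≅ e.terFunctor.obj (d.terFunctor.obj X) where
  hom := fun r p => Term.var
    (⟨p.2.1.1, p.2.1.2.1, Var.join e.sort p.2.1.2.2 p.2.2⟩ : (d.comp e).copr X.family r)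
  inv := fun r p => flat e.sort (A := Term Om (e.copr (d.copr X.family)))
    (fun t j r k => Term.var (⟨t, ⟨p.1, p.2.1, j⟩, k⟩ : e.copr (d.copr X.family) r)) r p.2.2
  hom_inv_id := by
    funext r p
    obtain ⟨s, x, k⟩ := p
    obtain ⟨t, j, k, rfl⟩ := exists_join k
    refine (congrArg (Term.bind _) (flat_join _ j k)).trans rfl
  inv_hom_id := by
    funext r p
    obtain ⟨t, ⟨s, x, j⟩, k⟩ := p
    exact flat_join (A := Term Om (e.copr (d.copr X.family)))
      (fun t j r k => Term.var (⟨t, ⟨s, x, j⟩, k⟩ : e.copr (d.copr X.family) r)) j k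

end ter

/-- The data of the pseudofunctor `Ter_pd`: it takes `Σ` to `Ter(Σ)`, a polyderivor `d` to `d_⋄`
and a transformation `ξ` to the substitutions of the terms `ξ_s`; its structural isomorphisms
relabel variables. -/
noncomputable def terPd : PseudofunctorData Signature.{u} Cat.{u, u + 1} where
  obj Sg := Cat.of (Ter Sg)
  map d := (Polyderivor.terFunctor d).toCatHom
  map₂ ξ := (Transformation.terNatTrans ξ).toCatHom₂
  mapId Sg := Cat.Hom.isoMk (NatIso.ofComponents (fun X => terId X) (by
    intro X Y P
    funext s y
    exact Polyderivor.translate_id (P s y)))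
  mapComp d e := Cat.Hom.isoMk (NatIso.ofComponents (fun X => terComp d e X) (by
    intro X Y P
    funext r p
    exact Polyderivor.translate_comp d e (P p.2.1.1 p.2.1.2.1) p.2.1.2.2 p.2.2))

/-! ### Realization of terms -/

/-- The functor `Tr^Σ : Alg(Σ) × Ter(Σ) ⥤ Set`, which takes `(A, X)` to `A_X = Hom(X, A)`, and
`(f, P)`, where `P : X → Y` in `Ter(Σ)`, to `A_X → B_Y`, `u ↦ f ∘ u^♯ ∘ P`. -/
def trFunctor (Sg : Signature.{u}) : Algebra.{u, u} Sg × Ter Sg ⥤ Type u where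
  obj p := SMap p.2.family p.1.carrier
  map {p q} f := ↾(fun (a : SMap p.2.family p.1.carrier) => (fun s y =>
    f.1.map s (p.1.eval a (f.2 s y)) : SMap q.2.family q.1.carrier))
  map_id _ := rfl
  map_comp {p q r} f g := by
    refine ConcreteCategory.hom_ext _ _ fun a => ?_
    funext s z
    refine congrArg (g.1.map s) ?_
    exact (congrArg (f.1.map s) (p.1.eval_bind a f.2 (g.2 s z))).trans (f.1.map_eval _ _)

/-- The natural isomorphism `θ^d`, with the components `Hom(X, d^* A) ≅ Hom(∐^†_φ X, A)`. -/
noncomputable def thetaIso {Sg La : Signature.{u}} (d : Polyderivor Sg La) :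
    d.pullbackFunctor.prod (𝟭 (Ter Sg)) ⋙ trFunctor Sg ≅
      (𝟭 (Algebra.{u, u} La)).prod d.terFunctor ⋙ trFunctor La :=
  NatIso.ofComponents (fun p => (d.transpose p.2.family p.1.carrier).toIso) (by
    intro p q f
    refine ConcreteCategory.hom_ext _ _ fun a => ?_
    funext t y
    exact congrArg (f.1.map t) (d.eval_translate p.1 a (f.2 y.1 y.2.1) t y.2.2).symm)

/-- The data of the pseudo-extranatural transformation `(Tr, θ)` from `Alg_pd(·) × Ter_pd(·)` to
the constant functor at `Set`; here `Alg_pd(1) × Ter_pd(d)` and `Alg_pd(d) × Ter_pd(1)` are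
identified with `1 × d_⋄` and `d^* × 1`. -/
noncomputable def trTheta : ExtranaturalData (algPd.times terPd) (Cat.of (Type u)) where
  app Sg := (trFunctor Sg).toCatHom
  iso {Sg La} d := Cat.Hom.isoMk (
    Functor.isoWhiskerRight (NatIso.prod (Iso.refl d.pullbackFunctor)
      (Cat.Hom.toNatIso (terPd.mapId Sg))) (trFunctor Sg) ≪≫
    thetaIso d ≪≫
    Functor.isoWhiskerRight (NatIso.prod (Cat.Hom.toNatIso (algPd.mapId (op La))).symm
      (Iso.refl (Polyderivor.terFunctor d))) (trFunctor La))

end ManySorted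

namespace ManySorted

/-! Every axiom is an equation between natural transformations, so it can be tested at one object.
From there `algPd` is tested at one tuple and one coordinate of its image, `terPd` at one variable
of the target (a morphism `X ⟶ Y` of terms is a map on the variables of `Y`), and `trTheta` at one
sorted map and one variable. A position in `φ^♯(w)` is the same thing as a block together with a
position inside that block (`Var.join`). In these coordinates the structural isomorphisms only
regroup or relabel indices.

What remains is to realize three kinds of transformations in an algebra `B`. The components
`ξ_{φ(s)}` of a left whiskering act block by block, each as a single `ξ_t` (`eval_whiskerLeft`). The
components `h^♯(ξ_s)` of a right whiskering act on `B` as `ξ_s` acts on `h^* B`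
(`eval_whiskerRight`). An associator or unitor comes from an equality of polyderivors and reads off
the coordinate in the same position (`eval_eqToHom`), so the coherence axioms come down to
arithmetic of positions in nested blocks.

The terms need no separate argument: the component at `X` of the natural transformation given by `ξ`
is the realization of `ξ` in the free algebra on `∐^†_φ X`, at the tuple of variables. The same
three facts, read in term algebras, give `whiskerLeft_bind`, `whiskerRight_bind` and the coherence
of `terPd`.

The isomorphism `θ^d` is a currying bijection. Its compatibility with 2-cells says that evaluating a
term after renaming its variables is evaluating it at the renamed assignment. In the pasting for a
composite, each structural 2-cell acts on a sorted map by reindexing (`leftComp_apply`,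
`exchange_apply`, `rightComp_apply`), and following one coordinate through the pasting leads back to
the coordinate that `θ` of the composite reads. -/

/-! ### Pseudofunctor axioms without inverses, and products of pseudofunctors -/

/-- The hypotheses mention only the `hom` of each structural isomorphism. For `algPd` and `terPd`
these compute by unfolding, whereas the inverses of `mapComp` involve `flat`, which is defined
through the inverse of a bijection and computes only after rewriting. -/
theorem PseudofunctorData.isPseudofunctor_of {B : Type*} [Bicategory B] {C : Type*} [Bicategory C]
    (F : PseudofunctorData B C)
    (map₂_id : ∀ {a b : B} (f : a ⟶ b), F.map₂ (𝟙 f) = 𝟙 (F.map f))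
    (map₂_comp : ∀ {a b : B} {f g h : a ⟶ b} (η : f ⟶ g) (ζ : g ⟶ h),
      F.map₂ (η ≫ ζ) = F.map₂ η ≫ F.map₂ ζ)
    (whiskerLeft : ∀ {a b c : B} (f : a ⟶ b) {g h : b ⟶ c} (η : g ⟶ h),
      F.map₂ (f ◁ η) ≫ (F.mapComp f h).hom = (F.mapComp f g).hom ≫ F.map f ◁ F.map₂ η)
    (whiskerRight : ∀ {a b c : B} {f g : a ⟶ b} (η : f ⟶ g) (h : b ⟶ c),
      F.map₂ (η ▷ h) ≫ (F.mapComp g h).hom = (F.mapComp f h).hom ≫ F.map₂ η ▷ F.map h)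
    (associator : ∀ {a b c d : B} (f : a ⟶ b) (g : b ⟶ c) (h : c ⟶ d),
      F.map₂ (α_ f g h).hom ≫ (F.mapComp f (g ≫ h)).hom ≫ F.map f ◁ (F.mapComp g h).hom =
        (F.mapComp (f ≫ g) h).hom ≫ (F.mapComp f g).hom ▷ F.map h ≫
          (α_ (F.map f) (F.map g) (F.map h)).hom)
    (leftUnitor : ∀ {a b : B} (f : a ⟶ b), F.map₂ (λ_ f).hom =
      (F.mapComp (𝟙 a) f).hom ≫ (F.mapId a).hom ▷ F.map f ≫ (λ_ (F.map f)).hom)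
    (rightUnitor : ∀ {a b : B} (f : a ⟶ b), F.map₂ (ρ_ f).hom =
      (F.mapComp f (𝟙 b)).hom ≫ F.map f ◁ (F.mapId b).hom ≫ (ρ_ (F.map f)).hom) :
    F.IsPseudofunctor :=
  ⟨{ toPrelaxFunctor := { toPrelaxFunctorStruct := F.toPrelaxFunctorStruct
                          map₂_id := map₂_id
                          map₂_comp := map₂_comp }
     mapId := F.mapId
     mapComp := F.mapComp
     map₂_whisker_left := fun f _ _ η => by
      rw [← Category.assoc]
      exact (Iso.eq_comp_inv _).2 (whiskerLeft f η)
     map₂_whisker_right := fun η h => by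
      rw [← Category.assoc]
      exact (Iso.eq_comp_inv _).2 (whiskerRight η h)
     map₂_associator := fun f g h => by
      have e := associator f g h
      -- The two inverses at the end of the axiom are cancelled by composing with the isomorphism
      -- they invert.
      rw [← cancel_mono ((F.mapComp f (g ≫ h)).hom ≫ F.map f ◁ (F.mapComp g h).hom)]
      refine e.trans ?_
      simp only [Category.assoc, Iso.inv_hom_id_assoc, Bicategory.whiskerLeft_inv_hom,
        Category.comp_id]
     map₂_left_unitor := leftUnitor
     map₂_right_unitor := rightUnitor }, rfl⟩

theorem cat_hom₂_ext {C D : Cat.{v, v'}} {F G : C ⟶ D} {η ζ : F ⟶ G}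
    (h : ∀ X, η.toNatTrans.app X = ζ.toNatTrans.app X) : η = ζ :=
  Cat.Hom₂.ext (NatTrans.ext (funext h))

/-- All data of the product are pairs, and so are the components of composites and whiskerings of
its 2-cells. Each axiom is therefore the pair of the corresponding axioms of the factors, taken at
the two coordinates of an object. -/
theorem PseudofunctorData.IsPseudofunctor.times {B : Type*} [Bicategory B] {C : Type*}
    [Bicategory C] {F : PseudofunctorData B Cat.{v, v'}} {G : PseudofunctorData C Cat.{v, v'}}
    (hF : F.IsPseudofunctor) (hG : G.IsPseudofunctor) : (F.times G).IsPseudofunctor := by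
  obtain ⟨P, rfl⟩ := hF
  obtain ⟨Q, rfl⟩ := hG
  have key {X Y : Cat.{v, v'}} {f g : X ⟶ Y} {η ζ : f ⟶ g} (h : η = ζ) (x : X) :
      η.toNatTrans.app x = ζ.toNatTrans.app x := by rw [h]
  refine PseudofunctorData.isPseudofunctor_of _ ?_ ?_ ?_ ?_ ?_ ?_ ?_
  · intro a b f
    exact cat_hom₂_ext fun X => Prod.ext (key (P.map₂_id f.1) X.1) (key (Q.map₂_id f.2) X.2)
  · intro a b f g h η ζ
    exact cat_hom₂_ext fun X => Prod.ext (key (P.map₂_comp η.1 ζ.1) X.1)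
      (key (Q.map₂_comp η.2 ζ.2) X.2)
  · intro a b c f g h η
    -- The axioms of the factors are first brought into the inverse-free form.
    have h1 : P.map₂ (f.1 ◁ η.1) ≫ (P.mapComp f.1 h.1).hom =
      (P.mapComp f.1 g.1).hom ≫ P.map f.1 ◁ P.map₂ η.1 := by simp
    have h2 : Q.map₂ (f.2 ◁ η.2) ≫ (Q.mapComp f.2 h.2).hom =
      (Q.mapComp f.2 g.2).hom ≫ Q.map f.2 ◁ Q.map₂ η.2 := by simp
    exact cat_hom₂_ext fun X => Prod.ext (key h1 X.1) (key h2 X.2)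
  · intro a b c f g η h
    have h1 : P.map₂ (η.1 ▷ h.1) ≫ (P.mapComp g.1 h.1).hom =
      (P.mapComp f.1 h.1).hom ≫ P.map₂ η.1 ▷ P.map h.1 := by simp
    have h2 : Q.map₂ (η.2 ▷ h.2) ≫ (Q.mapComp g.2 h.2).hom =
      (Q.mapComp f.2 h.2).hom ≫ Q.map₂ η.2 ▷ Q.map h.2 := by simp
    exact cat_hom₂_ext fun X => Prod.ext (key h1 X.1) (key h2 X.2)
  · intro a b c d f g h
    have h1 : P.map₂ (α_ f.1 g.1 h.1).hom ≫ (P.mapComp f.1 (g.1 ≫ h.1)).hom ≫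
        P.map f.1 ◁ (P.mapComp g.1 h.1).hom = (P.mapComp (f.1 ≫ g.1) h.1).hom ≫
          (P.mapComp f.1 g.1).hom ▷ P.map h.1 ≫ (α_ (P.map f.1) (P.map g.1) (P.map h.1)).hom := by
      rw [P.map₂_associator]
      simp only [Category.assoc, Iso.inv_hom_id_assoc, Bicategory.whiskerLeft_inv_hom,
        Category.comp_id]
    have h2 : Q.map₂ (α_ f.2 g.2 h.2).hom ≫ (Q.mapComp f.2 (g.2 ≫ h.2)).hom ≫
        Q.map f.2 ◁ (Q.mapComp g.2 h.2).hom = (Q.mapComp (f.2 ≫ g.2) h.2).hom ≫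
          (Q.mapComp f.2 g.2).hom ▷ Q.map h.2 ≫ (α_ (Q.map f.2) (Q.map g.2) (Q.map h.2)).hom := by
      rw [Q.map₂_associator]
      simp only [Category.assoc, Iso.inv_hom_id_assoc, Bicategory.whiskerLeft_inv_hom,
        Category.comp_id]
    exact cat_hom₂_ext fun X => Prod.ext (key h1 X.1) (key h2 X.2)
  · intro a b f
    exact cat_hom₂_ext fun X => Prod.ext (key (P.map₂_left_unitor f.1) X.1)
      (key (Q.map₂_left_unitor f.2) X.2)
  · intro a b f
    exact cat_hom₂_ext fun X => Prod.ext (key (P.map₂_right_unitor f.1) X.1)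
      (key (Q.map₂_right_unitor f.2) X.2)

/-! ### Realizations of whiskerings and of coherence 2-cells -/

section elements

variable {Sg La Om Th : Signature.{u}}

/-- Block `j` of `h^♯(ξ_s)` is `h^♯` of the term `(ξ_s)_j`, and by `eval_ext` the realization of
`h^♯(P)` in `B` is the realization of `P` in `h^* B`, once the tuple `x` is cut into its blocks. -/
theorem eval_whiskerRight {d e : Polyderivor Sg La} (ξ : d ⟶ e) (h : Polyderivor La Om)
    (B : Algebra.{u, v} Om) {s : Sg.sorts} (x : Tup B.carrier ((d.comp h).sort s)) {t : La.sorts}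
    (j : Var (e.sort s) t) {r : Om.sorts} (k : Var (h.sort t) r) :
    B.eval x ((Transformation.whiskerRight ξ h).comp s r (Var.join h.sort j k)) =
      (h.pullback B).eval (fun _ j r k => x r (Var.join h.sort j k)) (ξ.comp s t j) r k := by
  refine (congrArg (B.eval x) (Polyderivor.map_join h (ξ.comp s) j k)).trans ?_
  rw [← Polyderivor.eval_ext]
  exact congrArg (fun x => B.eval x _) (flat_unflat x).symm

/-- Block `j` of `ξ_{φ(s)}` is `ξ_t` with its variables moved into block `j`; evaluating after this
renaming restricts `x` to that block. -/
theorem eval_whiskerLeft (d : Polyderivor Sg La) {e h : Polyderivor La Om} (ξ : e ⟶ h)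
    (B : Algebra.{u, v} Om) {s : Sg.sorts} (x : Tup B.carrier ((d.comp e).sort s)) {t : La.sorts}
    (j : Var (d.sort s) t) {r : Om.sorts} (k : Var (h.sort t) r) :
    B.eval x ((Transformation.whiskerLeft d ξ).comp s r (Var.join h.sort j k)) =
      B.eval (fun r k => x r (Var.join e.sort j k)) (ξ.comp t r k) :=
  (congrArg (B.eval x) (wordExt_join ξ.comp j k)).trans (B.eval_bind _ _ _)

/-- An identity transformation consists of variables, so it realizes as a projection. The words
`d.sort s` and `e.sort s` are only provably equal; comparing the variables by position keeps casts
out of the statement. -/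
theorem eval_eqToHom {d e : Polyderivor Sg La} (h : d = e) (B : Algebra.{u, v} La) {s : Sg.sorts}
    (x : Tup B.carrier (d.sort s)) {t : La.sorts} (j : Var (e.sort s) t) {k : Var (d.sort s) t}
    (hk : k.pos = j.pos) : B.eval x ((eqToHom h : d ⟶ e).comp s t j) = x t k := by
  subst h
  obtain rfl : k = j := Var.ext hk
  rfl

theorem translate_bind_transpose (d : Polyderivor Sg La) {X : Sg.sorts → Type v}
    {Y : La.sorts → Type v'} (f : SMap X (d.pullback (termAlg La Y)).carrier) {s : Sg.sorts}
    (P : Term Sg X s) {t : La.sorts} (j : Var (d.sort s) t) :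
    (d.translate P t j).bind (d.transpose X _ f) =
      (d.pullback (termAlg La Y)).eval f P t j :=
  d.eval_translate (termAlg La Y) f P t j

/-- This is the naturality of `mapComp` for right whiskering, at one variable of the iterated
coproduct. Both sides are the value of `(ξ_s)_j` in `h^*` of the free algebra on the coproduct for
`d.comp h`: the left one by `eval_whiskerRight`, the right one by the universal property of
`translate`. -/
theorem whiskerRight_bind {d e : Polyderivor Sg La} (ξ : d ⟶ e) (h : Polyderivor La Om)
    (X : Sg.sorts → Type v) {s : Sg.sorts} (x : X s) {t : La.sorts} (j : Var (e.sort s) t)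
    {r : Om.sorts} (k : Var (h.sort t) r) :
    ((Transformation.whiskerRight ξ h).comp s r (Var.join h.sort j k)).bind
        (fun _ l => Term.var (⟨s, x, l⟩ : (d.comp h).copr X _)) =
      (h.translate (Transformation.ter ξ X t ⟨s, x, j⟩) r k).bind (fun r p => Term.var
        (⟨p.2.1.1, p.2.1.2.1, Var.join h.sort p.2.1.2.2 p.2.2⟩ : (d.comp h).copr X r)) := by
  refine (eval_whiskerRight ξ h (termAlg Om ((d.comp h).copr X)) _ j k).trans ?_
  refine Eq.trans ?_ (translate_bind_transpose h
    (fun t (p : d.copr X t) r k => Term.var (⟨p.1, p.2.1, Var.join h.sort p.2.2 k⟩ :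
      (d.comp h).copr X r)) _ k).symm
  exact (congrFun (congrFun ((h.pullback (termAlg Om ((d.comp h).copr X))).eval_bind
    (fun t (p : d.copr X t) r k => Term.var (⟨p.1, p.2.1, Var.join h.sort p.2.2 k⟩ :
      (d.comp h).copr X r)) (fun t k => Term.var (⟨s, x, k⟩ : d.copr X t)) (ξ.comp s t j)) r)
    k).symm

/-- The counterpart for left whiskering: both sides rename the variables of `ξ_t` into block `j` of
the copy labelled by `x`, the right one in two stages. -/
theorem whiskerLeft_bind (d : Polyderivor Sg La) {e h : Polyderivor La Om} (ξ : e ⟶ h)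
    (X : Sg.sorts → Type v) {s : Sg.sorts} (x : X s) {t : La.sorts} (j : Var (d.sort s) t)
    {r : Om.sorts} (k : Var (h.sort t) r) :
    ((Transformation.whiskerLeft d ξ).comp s r (Var.join h.sort j k)).bind
        (fun _ l => Term.var (⟨s, x, l⟩ : (d.comp e).copr X _)) =
      (Transformation.ter ξ (d.copr X) r ⟨t, ⟨s, x, j⟩, k⟩).bind (fun r p => Term.var
        (⟨p.2.1.1, p.2.1.2.1, Var.join e.sort p.2.1.2.2 p.2.2⟩ : (d.comp e).copr X r)) :=
  (eval_whiskerLeft d ξ (termAlg Om ((d.comp e).copr X)) _ j k).trans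
    (Term.bind_bind (fun r (p : e.copr (d.copr X) r) => Term.var
        (⟨p.2.1.1, p.2.1.2.1, Var.join e.sort p.2.1.2.2 p.2.2⟩ : (d.comp e).copr X r))
      (fun r k => Term.var (⟨t, ⟨s, x, j⟩, k⟩ : e.copr (d.copr X) r)) (ξ.comp t r k)).symm

theorem ter_comp {d e h : Polyderivor Sg La} (ξ : d ⟶ e) (χ : e ⟶ h) (X : Sg.sorts → Type v) :
    Transformation.ter (ξ ≫ χ) X = kcomp (Transformation.ter ξ X) (Transformation.ter χ X) := by
  funext t p
  exact (Term.bind_bind _ _ _).trans (Term.bind_bind (Transformation.ter ξ X)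
    (fun t k => Term.var (⟨p.1, p.2.1, k⟩ : e.copr X t)) (χ.comp p.1 t p.2.2)).symm

end elements

/-! ### The two pseudofunctors -/

theorem algPd_isPseudofunctor : algPd.{u}.IsPseudofunctor := by
  refine PseudofunctorData.isPseudofunctor_of _ ?_ ?_ ?_ ?_ ?_ ?_ ?_
  · intro a b f
    exact cat_hom₂_ext fun B => Algebra.hom_ext fun s x => rfl
  · intro a b f g h η ζ
    refine cat_hom₂_ext fun B => Algebra.hom_ext fun s x => ?_
    funext t j
    exact Algebra.eval_bind B x (η.unop2.comp s) (ζ.unop2.comp s t j)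
  · intro a b c f g h η
    refine cat_hom₂_ext fun B => Algebra.hom_ext fun s x => ?_
    funext t j r k
    -- Passing to the opposite exchanges the two whiskerings; below it likewise exchanges the two
    -- unitors and inverts the associator.
    exact eval_whiskerRight η.unop2 f.unop B x j k
  · intro a b c f g η h
    refine cat_hom₂_ext fun B => Algebra.hom_ext fun s x => ?_
    funext t j r k
    exact eval_whiskerLeft h.unop η.unop2 B x j k
  · intro a b c d f g h
    refine cat_hom₂_ext fun B => Algebra.hom_ext fun s x => ?_
    funext t j r k q l
    -- Both bracketings of the three nested blocks put the coordinate at the same position.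
    exact eval_eqToHom (Polyderivor.comp_assoc h.unop g.unop f.unop).symm B x _
      (congrArg Var.pos (Var.join_join g.unop.sort f.unop.sort j k l List.flatMap_assoc)).symm
  · intro a b f
    refine cat_hom₂_ext fun B => Algebra.hom_ext fun s x => ?_
    funext t j
    exact eval_eqToHom (Polyderivor.comp_id' f.unop) B x _
      (congrArg Var.pos (Var.join_one j (List.flatMap_singleton' _)))
  · intro a b f
    refine cat_hom₂_ext fun B => Algebra.hom_ext fun s x => ?_
    funext t j
    exact eval_eqToHom (Polyderivor.id_comp' f.unop) B x _
      (congrArg Var.pos (Var.join_single (Var.one s) j (List.flatMap_singleton _ _)))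

theorem terPd_isPseudofunctor : terPd.{u}.IsPseudofunctor := by
  refine PseudofunctorData.isPseudofunctor_of _ ?_ ?_ ?_ ?_ ?_ ?_ ?_
  · intro a b f
    exact cat_hom₂_ext fun X => rfl
  · intro a b f g h η ζ
    exact cat_hom₂_ext fun X => ter_comp η ζ X.family
  · intro a b c f g h η
    refine cat_hom₂_ext fun X => ?_
    funext r p
    -- The target is the iterated coproduct, so a variable already comes with its block `j` and its
    -- position `k` in the block.
    obtain ⟨t, ⟨s, x, j⟩, k⟩ := p
    exact whiskerLeft_bind f η X.family x j k
  · intro a b c f g η h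
    refine cat_hom₂_ext fun X => ?_
    funext r p
    obtain ⟨t, ⟨s, x, j⟩, k⟩ := p
    exact whiskerRight_bind η h X.family x j k
  · intro a b c d f g h
    refine cat_hom₂_ext fun X => ?_
    funext q p
    obtain ⟨r, ⟨t, ⟨s, x, j⟩, k⟩, l⟩ := p
    -- Substitution is evaluation in a free algebra; here the tuple consists of the variables
    -- labelled by `x`.
    exact eval_eqToHom (Polyderivor.comp_assoc f g h)
      (termAlg d (((f.comp g).comp h).copr X.family))
      (fun _ l => Term.var ⟨s, x, l⟩) _
      (congrArg Var.pos (Var.join_join g.sort h.sort j k l List.flatMap_assoc))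
  · intro a b f
    refine cat_hom₂_ext fun X => ?_
    funext t p
    obtain ⟨s, x, j⟩ := p
    exact eval_eqToHom (Polyderivor.id_comp' f)
      (termAlg b (((Polyderivor.id a).comp f).copr X.family))
      (fun _ l => Term.var ⟨s, x, l⟩) _
      (congrArg Var.pos (Var.join_single (Var.one s) j (List.flatMap_singleton _ _)))
  · intro a b f
    refine cat_hom₂_ext fun X => ?_
    funext t p
    obtain ⟨s, x, j⟩ := p
    exact eval_eqToHom (Polyderivor.comp_id' f)
      (termAlg b ((f.comp (Polyderivor.id b)).copr X.family))
      (fun _ l => Term.var ⟨s, x, l⟩) _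
      (congrArg Var.pos (Var.join_one j (List.flatMap_singleton' _)))

/-! ### The structural 2-cells of the product, acting on sorted maps -/

section realization

variable {Sg La Om : Signature.{u}}

theorem eval_eqToHom_comp {d e h : Polyderivor Sg La} (h₁ : d = e) (h₂ : e = h)
    (B : Algebra.{u, v} La) {s : Sg.sorts} (x : Tup B.carrier (d.sort s)) {t : La.sorts}
    (j : Var (h.sort s) t) {k : Var (d.sort s) t} (hk : k.pos = j.pos) :
    B.eval x ((eqToHom h₁ ≫ eqToHom h₂ : d ⟶ h).comp s t j) = x t k := by
  rw [eqToHom_trans]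
  exact eval_eqToHom _ B x j hk

/-- The bijection between one-letter tuples and elements is a homomorphism, hence commutes with
evaluation. -/
theorem eval_id_pullback {X : Sg.sorts → Type v} (B : Algebra.{u, u} Sg)
    (b : SMap X ((Polyderivor.id Sg).pullback B).carrier) {s : Sg.sorts} (P : Term Sg X s) :
    ((Polyderivor.id Sg).pullback B).eval b P s (Var.one s) =
      B.eval (fun t x => b t x t (Var.one t)) P :=
  (pullbackId B).hom.map_eval b P

/-- The action of `Tr^Σ` on morphisms, as a function. -/
abbrev trMap {p q : Algebra.{u, u} Sg × Ter Sg} (f : p ⟶ q) (v : SMap p.2.family p.1.carrier) :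
    SMap q.2.family q.1.carrier :=
  ConcreteCategory.hom (C := Type u) ((trFunctor Sg).map f) v

/-- On the side of algebras a tuple is cut into blocks; on the side of terms `F(f, 1)` and `F(g, 1)`
each contribute a one-letter label, and the inverse unitor merges the two labels into one. -/
theorem leftComp_apply (f : Polyderivor Sg La) (g : Polyderivor La Om) (A : Algebra.{u, u} Om)
    (Y : Ter Sg)
    (v : SMap ((Polyderivor.id Sg).copr Y.family) ((f.comp g).pullback A).carrier) {s : Sg.sorts}
    (y : Y.family s) {t : La.sorts} (j : Var (f.sort s) t) {r : Om.sorts} (k : Var (g.sort t) r) :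
    (trMap (((algPd.times terPd).leftComp (a := Sg) (b := La) (c := Om) f g Sg).toNatTrans.app
      (A, Y)) v : SMap ((Polyderivor.id Sg).copr ((Polyderivor.id Sg).copr Y.family))
        (f.pullback (g.pullback A)).carrier)
      s ⟨s, ⟨s, y, Var.one s⟩, Var.one s⟩ t j r k = v s ⟨s, y, Var.one s⟩ r (Var.join g.sort j k) := by
  have h := eval_eqToHom (Polyderivor.id_comp' (Polyderivor.id Sg)).symm
    ((f.comp g).pullback A) (fun _ l => v _ ⟨s, y, l⟩)
    (Var.join (Polyderivor.id Sg).sort (Var.one s) (Var.one s)) (k := Var.one s) rfl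
  have h' := ((f.comp g).pullback A).eval_bind v (fun _ l => Term.var ⟨s, y, l⟩)
    ((eqToHom (Polyderivor.id_comp' (Polyderivor.id Sg)).symm).comp s _
      (Var.join (Polyderivor.id Sg).sort (Var.one s) (Var.one s)))
  exact congrFun (congrFun (h'.trans h) r) _

/-- The roles are reversed: blocks of variables are joined on the side of terms, and a doubled
one-letter tuple is collapsed on the side of algebras. Inverses of `mapComp` occur on both sides and
are computed by `flat_join`. -/
theorem rightComp_apply (f : Polyderivor Sg La) (g : Polyderivor La Om) (A : Algebra.{u, u} Om)
    (Y : Ter Sg)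
    (v : SMap (g.copr (f.copr Y.family))
      ((Polyderivor.id Om).pullback ((Polyderivor.id Om).pullback A)).carrier) {s : Sg.sorts}
    (y : Y.family s) {t : La.sorts} (j : Var (f.sort s) t) {r : Om.sorts} (k : Var (g.sort t) r) :
    (trMap (((algPd.times terPd).rightComp Om (a := Sg) (b := La) (c := Om) f g).toNatTrans.app
      (A, Y)) v : SMap ((f.comp g).copr Y.family) ((Polyderivor.id Om).pullback A).carrier)
      r ⟨s, y, Var.join g.sort j k⟩ r (Var.one r) =
      v r ⟨t, ⟨s, y, j⟩, k⟩ r (Var.one r) r (Var.one r) := by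
  refine (eval_eqToHom (Polyderivor.comp_id' (Polyderivor.id Om)) A _ _
    (k := Var.join (Polyderivor.id Om).sort (Var.one r) (Var.one r)) rfl).trans ?_
  refine (flat_join (φ := (Polyderivor.id Om).sort) _ (Var.one r) (Var.one r)).trans ?_
  have h := flat_join (φ := g.sort) (A := Term Om (g.copr (f.copr Y.family)))
    (fun t j r k => Term.var (⟨t, ⟨s, y, j⟩, k⟩ : g.copr (f.copr Y.family) r)) j k
  exact congrArg (fun P => ((Polyderivor.id Om).pullback
    ((Polyderivor.id Om).pullback A)).eval v P r (Var.one r) r (Var.one r)) h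

/-- On either side the one-letter block passes from one end of the composite to the other. Neither
`(one, k)` nor `(k, one)` shifts the position of `k`, so only the labels change. -/
theorem exchange_apply (f : Polyderivor Sg La) (g : Polyderivor La Om) (A : Algebra.{u, u} Om)
    (Y : Ter Sg)
    (v : SMap (f.copr ((Polyderivor.id Sg).copr Y.family))
      ((Polyderivor.id La).pullback (g.pullback A)).carrier) {s : Sg.sorts}
    (y : Y.family s) {t : La.sorts} (j : Var (f.sort s) t) {r : Om.sorts} (k : Var (g.sort t) r) :
    (trMap (((algPd.times terPd).exchange (a := Sg) (a' := La) (b := La) (b' := Om) f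
      g).toNatTrans.app (A, Y)) v : SMap ((Polyderivor.id La).copr (f.copr Y.family))
        (g.pullback ((Polyderivor.id Om).pullback A)).carrier)
      t ⟨t, ⟨s, y, j⟩, Var.one t⟩ r k r (Var.one r) =
      v t ⟨s, ⟨s, y, Var.one s⟩, j⟩ t (Var.one t) r k := by
  refine (eval_eqToHom_comp (Polyderivor.id_comp' g) (Polyderivor.comp_id' g).symm A _ _
    (k := Var.join g.sort (Var.one t) k) ?_).trans ?_
  · exact congrArg Var.pos ((Var.join_single (Var.one t) k (List.flatMap_singleton _ _)).trans
      (Var.join_one k (List.flatMap_singleton' _)).symm)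
  refine (flat_join (φ := g.sort) _ (Var.one t) k).trans ?_
  -- The side of algebras is settled; `B` is the algebra in which the terms are evaluated, and `P`
  -- is the inverse of the isomorphism splitting the coproduct for `id.comp f`.
  let B := (Polyderivor.id La).pullback (g.pullback A)
  let P := fun t (q : ((Polyderivor.id Sg).comp f).copr Y.family t) =>
    flat f.sort (A := Term La (f.copr ((Polyderivor.id Sg).copr Y.family)))
      (fun s' i t j => Term.var (⟨s', ⟨q.1, q.2.1, i⟩, j⟩ :
        f.copr ((Polyderivor.id Sg).copr Y.family) t)) t q.2.2
  have h₁ := eval_eqToHom_comp (Polyderivor.id_comp' f) (Polyderivor.comp_id' f).symm B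
    (fun t l => B.eval v (P t ⟨s, y, l⟩)) (Var.join (Polyderivor.id La).sort j (Var.one t))
    (k := Var.join f.sort (Var.one s) j)
    (congrArg Var.pos ((Var.join_single (Var.one s) j (List.flatMap_singleton _ _)).trans
      (Var.join_one j (List.flatMap_singleton' _)).symm))
  let Q := ((eqToHom (Polyderivor.id_comp' f) ≫ eqToHom (Polyderivor.comp_id' f).symm).comp s t
      (Var.join (Polyderivor.id La).sort j (Var.one t)))
  -- The term to be evaluated is `Q` under two substitutions, the labelling by `y` and then `P`;
  -- they are absorbed into the assignment one at a time.
  have h₂ := B.eval_bind v P (Q.bind fun _ l => Term.var ⟨s, y, l⟩)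
  have h₃ := B.eval_bind (fun t l => B.eval v (P t l)) (fun _ l => Term.var ⟨s, y, l⟩) Q
  have h₄ : P t ⟨s, y, Var.join f.sort (Var.one s) j⟩ = Term.var ⟨s, ⟨s, y, Var.one s⟩, j⟩ :=
    flat_join _ (Var.one s) j
  have h₅ := h₂.trans (h₃.trans (h₁.trans (congrArg (B.eval v) h₄)))
  exact congrFun (congrFun (congrFun (congrFun h₅ t) (Var.one t)) r) k

end realization

/-! ### Pseudo-extranaturality of term realization -/

theorem trTheta_isPseudoExtranatural : trTheta.{u}.IsPseudoExtranatural where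
  naturality {c c'} f g ξ := by
    refine cat_hom₂_ext fun X => ?_
    obtain ⟨A, Y⟩ := X
    refine ConcreteCategory.hom_ext (C := Type u) _ _ fun a => ?_
    funext t p
    obtain ⟨s, y, j⟩ := p
    -- The values lie in the pullback of `A` along the identity polyderivor, so they are one-letter
    -- tuples with a single coordinate to compare.
    refine single_ext ?_
    refine Eq.trans ?_ (eval_id_pullback A _ ((ξ.comp s t j).bind _)).symm
    exact (A.eval_bind (fun t p => a p.1 ⟨p.1, p.2.1, Var.one p.1⟩ t p.2.2)
      (fun _ k => Term.var (⟨s, y, k⟩ : f.copr Y.family _)) (ξ.comp s t j)).symm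
  iso_comp {a b c} f g := by
    refine cat_hom₂_ext fun X => ?_
    obtain ⟨A, Y⟩ := X
    refine ConcreteCategory.hom_ext (C := Type u) _ _ fun v => ?_
    funext r p
    obtain ⟨s, y, k⟩ := p
    obtain ⟨t, j, k, rfl⟩ := exists_join k
    refine single_ext ?_
    -- The pasting is peeled off from its last 2-cell to its first. The whiskered copies of `θ` in
    -- between are reindexings that hold by unfolding.
    refine Eq.trans ?_ (rightComp_apply f g A Y _ y j k).symm
    refine Eq.trans ?_ (exchange_apply f g A Y _ y j k).symm
    exact (leftComp_apply f g A Y v y j k).symm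
  iso_id c := by
    refine cat_hom₂_ext fun X => ?_
    obtain ⟨A, Y⟩ := X
    refine ConcreteCategory.hom_ext (C := Type u) _ _ fun a => ?_
    funext t p
    obtain ⟨s, y, j⟩ := p
    -- Once `j` is the only variable of its one-letter word, currying and the unit relabellings
    -- cancel by computation.
    obtain ⟨rfl, hj⟩ := Var.eq_one j
    obtain rfl : j = Var.one _ := hj
    exact single_ext rfl

end ManySorted

theorem proposition71 :
    ManySorted.algPd.{u}.IsPseudofunctor ∧
    ManySorted.terPd.{u}.IsPseudofunctor ∧
    (ManySorted.algPd.{u}.times ManySorted.terPd.{u}).IsPseudofunctor ∧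
    ManySorted.trTheta.{u}.IsPseudoExtranatural ∧
    ManySorted.IsTwoInstitution ManySorted.Signature.{u} ManySorted.algPd ManySorted.terPd
      (CategoryTheory.Cat.of (Type u)) ManySorted.trTheta := by
  have hAlg := ManySorted.algPd_isPseudofunctor
  have hTer := ManySorted.terPd_isPseudofunctor
  exact ⟨hAlg, hTer, hAlg.times hTer, ManySorted.trTheta_isPseudoExtranatural,
    ⟨hAlg, hTer, ManySorted.trTheta_isPseudoExtranatural⟩⟩
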